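/- A 2PFA verifier is a two-way probabilistic finite automaton, with arbitrary real transition probabilities, reading an input word $w$ between two end-markers and exchanging symbols of a finite alphabet with a prover. When in a communicating state, the verifier sends the symbol attached to the state and moves to a state determined by the prover's reply. The prover sees only $w$ and the symbols sent by the verifier (not its coin tosses) and is otherwise unrestricted. The verifier verifies a language $L$ with bounded error if, for some $\varepsilon<\frac12$, there is a prover with which every $w\in L$ is accepted with probability at least $1-\varepsilon$, and every $w\notin L$ is rejected with probability at least $1-\varepsilon$ whatever the prover. It runs in quadratic expected time if, on every input of length $n$ and with every prover, its expected number of steps is $O(n^2)$ (that is, at most $K(n^2+1)$ for a constant $K$ depending only on the verifier). For every set $I$ of positive integers, the unary language $$\mathtt{UPOWER64}(I)=\{a^{64^k}\mid k\in I\}$$ is verified with bounded error by a 2PFA verifier in quadratic expected time. Consequently, 2PFA verifiers can verify uncountably many unary languages with bounded error in quadratic expected time. -/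

import Mathlib

open scoped ENNReal

/-- Contents of the cells of the input tape `¢ w $`: the two end-markers and the input symbols. -/
inductive TapeSymbol (A : Type) : Type
  | leftEnd : TapeSymbol A
  | letter (a : A) : TapeSymbol A
  | rightEnd : TapeSymbol A

/-- The moves of the input head. -/
inductive HeadMove : Type
  | left : HeadMove
  | stay : HeadMove
  | right : HeadMove

/-- The states of a verifier with reading states `R` and communicating states `C`; there are two
halting states, the accepting one and the rejecting one. -/
inductive VerifierState (R C : Type) : Type
  | reading (s : R) : VerifierState R C
  | communicating (s : C) : VerifierState R C
  | accept : VerifierState R C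
  | reject : VerifierState R C

/-- A private-coin two-way probabilistic finite automaton verifier over the input alphabet `A`.
Transition probabilities are arbitrary real numbers. -/
structure TwoPFAVerifier (A : Type) where
  /-- the reading states -/
  R : Type
  /-- the communicating states -/
  C : Type
  /-- the communication alphabet -/
  U : Type
  finite_R : Finite R
  finite_C : Finite C
  finite_U : Finite U
  nonempty_U : Nonempty U
  /-- the initial state, which is a reading state -/
  start : R
  /-- `readStep s x` is the probability distribution of the next state and the head move, when the
  symbol `x` is read in the reading state `s` -/
  readStep : R → TapeSymbol A → PMF (VerifierState R C × HeadMove)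
  /-- the symbol that is written on the communication cell in a communicating state -/
  message : C → U
  /-- the next state, given the symbol with which the prover replies -/
  commStep : C → U → VerifierState R C

/-- The symbol in cell `i` of the tape `¢ w $`, whose cells are `0, …, |w| + 1`. -/
def tapeSymbolAt {A : Type} (w : List A) : ℕ → TapeSymbol A
  | 0 => TapeSymbol.leftEnd
  | i + 1 => (w[i]?).elim TapeSymbol.rightEnd TapeSymbol.letter

/-- The head position after a move. The head never leaves the tape `¢ w $`: a move beyond an
end-marker leaves it where it is. -/
def moveHead {A : Type} (w : List A) (i : ℕ) : HeadMove → ℕ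
  | HeadMove.left => i - 1
  | HeadMove.stay => i
  | HeadMove.right => min (i + 1) (w.length + 1)

namespace TwoPFAVerifier

variable {A : Type}

/-- A prover sees the input and the symbols that the verifier has written on the communication
cell so far (the oldest first, the current one last), and nothing else; it replies with a symbol.
There is no restriction on its computational power. -/
def Prover (V : TwoPFAVerifier A) : Type := List A → List V.U → V.U

/-- A configuration: state, head position, and the symbols sent so far by the verifier. -/
structure Config (V : TwoPFAVerifier A) : Type where
  state : VerifierState V.R V.C
  head : ℕ
  sent : List V.U

/-- The initial configuration, with the head on the left end-marker. -/
def init (V : TwoPFAVerifier A) : V.Config := ⟨VerifierState.reading V.start, 0, []⟩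

/-- One step on the input `w` with the prover `P`. Halting configurations do not change. -/
noncomputable def step (V : TwoPFAVerifier A) (P : V.Prover) (w : List A) :
    V.Config → PMF V.Config
  | ⟨VerifierState.reading s, i, h⟩ =>
      (V.readStep s (tapeSymbolAt w i)).map fun r => ⟨r.1, moveHead w i r.2, h⟩
  | ⟨VerifierState.communicating s, i, h⟩ =>
      PMF.pure ⟨V.commStep s (P w (h ++ [V.message s])), i, h ++ [V.message s]⟩
  | ⟨VerifierState.accept, i, h⟩ => PMF.pure ⟨VerifierState.accept, i, h⟩
  | ⟨VerifierState.reject, i, h⟩ => PMF.pure ⟨VerifierState.reject, i, h⟩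

/-- The distribution of the configuration after `t` steps. -/
noncomputable def run (V : TwoPFAVerifier A) (P : V.Prover) (w : List A) : ℕ → PMF V.Config
  | 0 => PMF.pure V.init
  | t + 1 => (run V P w t).bind (V.step P w)

/-- The probability that `V`, communicating with `P`, accepts `w`: the supremum (which is the
limit) over `t` of the probability of having accepted within `t` steps. -/
noncomputable def acceptProb (V : TwoPFAVerifier A) (P : V.Prover) (w : List A) : ℝ≥0∞ :=
  ⨆ t : ℕ, (V.run P w t).toOuterMeasure {c | c.state = VerifierState.accept}

/-- The probability that `V`, communicating with `P`, rejects `w`. -/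
noncomputable def rejectProb (V : TwoPFAVerifier A) (P : V.Prover) (w : List A) : ℝ≥0∞ :=
  ⨆ t : ℕ, (V.run P w t).toOuterMeasure {c | c.state = VerifierState.reject}

/-- The expected number of steps that are carried out until the computation halts: the sum over
`t` of the probability that the computation has not halted after `t` steps. -/
noncomputable def expectedTime (V : TwoPFAVerifier A) (P : V.Prover) (w : List A) : ℝ≥0∞ :=
  ∑' t : ℕ, (V.run P w t).toOuterMeasure
    {c | c.state ≠ VerifierState.accept ∧ c.state ≠ VerifierState.reject}

/-- `V` verifies the language `L` with error bound `ε`: completeness and soundness. -/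
def Verifies (V : TwoPFAVerifier A) (L : Language A) (ε : ℝ≥0∞) : Prop :=
  (∃ P : V.Prover, ∀ w ∈ L, 1 - ε ≤ V.acceptProb P w) ∧
  (∀ w ∉ L, ∀ P : V.Prover, 1 - ε ≤ V.rejectProb P w)

/-- The expected running time is quadratic in the input length, on every input and with every
prover. -/
def QuadraticExpectedTime (V : TwoPFAVerifier A) : Prop :=
  ∃ K : ℕ, ∀ (w : List A) (P : V.Prover),
    V.expectedTime P w ≤ ((K * (w.length ^ 2 + 1) : ℕ) : ℝ≥0∞)

end TwoPFAVerifier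

/-- `L` is verified by a 2PFA with bounded error in quadratic expected time. -/
def VerifiableInQuadraticTime {A : Type} (L : Language A) : Prop :=
  ∃ V : TwoPFAVerifier A,
    (∃ ε : ℝ≥0∞, ε < 1 / 2 ∧ V.Verifies L ε) ∧ V.QuadraticExpectedTime

/-- The unary word `a ^ (64 ^ k)`. As `64 ^ k` increases strictly with `k`, it is, for `k > 0`, the
`k`-th shortest member of `{a ^ (64 ^ m) | m > 0}`. -/
def upower64Word (k : ℕ+) : List Unit := List.replicate (64 ^ (k : ℕ)) ()

/-- The language `UPOWER64(I)` of the words `a ^ (64 ^ k)` with `k ∈ I`. -/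
def UPOWER64 (I : Set ℕ+) : Language Unit := {w | ∃ k ∈ I, w = upower64Word k}

/-! The verifier always sends the same symbol, so a prover amounts to a fixed sequence `σ` of
certificate symbols, chosen in ignorance of the coin tosses. On an input of length `n ≥ 2` the
verifier secretly picks one of five checks, each with probability 1/9, and otherwise rejects. Two
checks force marks of periods `n` and `n + 1`; their first coincidence then marks `n (n + 1)`
symbols. Two more compare adjacent blocks of a chain of lengths `n, n / 64, …, 1`, one from the
first block on, the other from the second; together they force `n` to be a power of 64.

The fifth check tosses a coin of bias `θ` until the marks coincide and counts heads modulo `32 (n +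
1)`, using the head position and 32 states. Here `θ` encodes `I` in base 64: for `n = 64 ^ k` the
mean number of passes over the tape is `16 (2 E + x + ρ)` with `x = 1` iff `k ∈ I` and `1/4 ≤ ρ ≤
3/4`. The standard deviation is at most half a pass, so by Chebyshev the number of passes modulo 32
reveals `x` with error at most 1/64.

Every check proceeds in cycles of expected length `O(n)`. Before each cycle the verifier gives up
and rejects with probability `1 / (64 (n + 1))`, by a random walk on the tape. Hence `O(n)` cycles
are expected with any prover, while the at most `n + 1` cycles of an honest run cost at most 1/64
per check.

Apart from these lapses, the first four checks are deterministic for given `σ`. Outside the language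
either one of them never accepts, which leaves acceptance probability at most 4/9, or all may
accept; then the certificate is correct as far as it matters (`lap_sound`, `whole_sound`,
`chain_sound`) and the count is almost surely adverse (`cnt_error`). With the honest certificate the
rejection probability exceeds 4/9 only slightly. The time bound is the potential argument of
`timeBound_step`. Uncountability follows from `UPOWER64_injective` and Cantor's theorem. -/

/-! ### Expectations under discrete distributions -/

namespace PMF

/-- The expectation of an extended nonnegative function. -/
noncomputable def expect {α : Type*} (q : PMF α) (f : α → ℝ≥0∞) : ℝ≥0∞ := ∑' a, q a * f a

variable {α β : Type*}

lemma expect_pure (a : α) (f : α → ℝ≥0∞) : (PMF.pure a).expect f = f a := by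
  classical
  unfold expect
  rw [tsum_eq_single a]
  · simp
  · intro b hb
    simp [PMF.pure_apply, hb]

lemma expect_bind (q : PMF α) (g : α → PMF β) (f : β → ℝ≥0∞) :
    (q.bind g).expect f = q.expect fun a => (g a).expect f := by
  unfold expect
  simp only [PMF.bind_apply, ← ENNReal.tsum_mul_right, ← ENNReal.tsum_mul_left]
  rw [ENNReal.tsum_comm]
  simp only [mul_assoc]

lemma expect_map (q : PMF α) (g : α → β) (f : β → ℝ≥0∞) :
    (q.map g).expect f = q.expect (f ∘ g) := by
  rw [← PMF.bind_pure_comp, expect_bind]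
  simp [Function.comp_def, expect_pure]

lemma toOuterMeasure_eq_expect (q : PMF α) (s : Set α) :
    q.toOuterMeasure s = q.expect (s.indicator 1) := by
  rw [PMF.toOuterMeasure_apply]
  unfold expect
  congr 1; ext a
  by_cases h : a ∈ s <;> simp [h]

lemma expect_mono (q : PMF α) {f g : α → ℝ≥0∞} (h : f ≤ g) : q.expect f ≤ q.expect g :=
  ENNReal.tsum_le_tsum fun a => mul_le_mul_right (h a) _

lemma expect_const (q : PMF α) (r : ℝ≥0∞) : q.expect (fun _ => r) = r := by
  unfold expect
  rw [ENNReal.tsum_mul_right, q.tsum_coe, one_mul]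

lemma expect_add (q : PMF α) (f g : α → ℝ≥0∞) :
    q.expect (f + g) = q.expect f + q.expect g := by
  unfold expect
  simp only [Pi.add_apply, mul_add]
  exact ENNReal.tsum_add

/-- A coin that shows `true` with probability `p`. -/
noncomputable def coin (p : unitInterval) : PMF Bool :=
  PMF.ofFintype (fun b => ENNReal.ofReal (if b then p else 1 - p)) (by
    rw [Fintype.sum_bool]
    simp only [if_true, Bool.false_eq_true, if_false]
    rw [← ENNReal.ofReal_add p.2.1 (by linarith [p.2.2])]
    simp)

lemma expect_coin (p : unitInterval) (f : Bool → ℝ≥0∞) :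
    (coin p).expect f =
      ENNReal.ofReal p * f true + ENNReal.ofReal (1 - p) * f false := by
  unfold expect
  rw [tsum_fintype, Fintype.sum_bool]
  simp [coin]

end PMF

/-! ### Halting probabilities and a drift bound for the expected time -/

namespace TwoPFAVerifier

variable {A : Type} (V : TwoPFAVerifier A) (P : V.Prover) (w : List A)

/-- The expectation of a function after one step. -/
noncomputable def next (f : V.Config → ℝ≥0∞) (c : V.Config) : ℝ≥0∞ := (V.step P w c).expect f

lemma expect_run (f : V.Config → ℝ≥0∞) (t : ℕ) :
    (V.run P w t).expect f = (V.next P w)^[t] f V.init := by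
  induction t generalizing f with
  | zero => simp [run, PMF.expect_pure]
  | succ t ih => rw [run, PMF.expect_bind, Function.iterate_succ_apply, ← ih]; rfl

lemma next_mono : Monotone (V.next P w) := fun _ _ h c => (V.step P w c).expect_mono h

lemma next_add (f g : V.Config → ℝ≥0∞) :
    V.next P w (f + g) = V.next P w f + V.next P w g :=
  funext fun c => (V.step P w c).expect_add f g

lemma iterate_next_add (f g : V.Config → ℝ≥0∞) (t : ℕ) :
    (V.next P w)^[t] (f + g) = (V.next P w)^[t] f + (V.next P w)^[t] g := by
  induction t generalizing f g with
  | zero => rfl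
  | succ t ih => simp only [Function.iterate_succ_apply, next_add, ih]

lemma iterate_next_one (t : ℕ) : (V.next P w)^[t] 1 = 1 := by
  have h : V.next P w 1 = 1 := funext fun c => (V.step P w c).expect_const 1
  exact Function.iterate_fixed h t

/-- The indicator of the configurations in state `q`. -/
noncomputable def inState (q : VerifierState V.R V.C) : V.Config → ℝ≥0∞ :=
  Set.indicator {c | c.state = q} 1

/-- The probability of reaching the halting state `q` from a given configuration. -/
noncomputable def haltProb (q : VerifierState V.R V.C) (c : V.Config) : ℝ≥0∞ :=
  ⨆ t : ℕ, (V.next P w)^[t] (V.inState q) c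

lemma acceptProb_eq : V.acceptProb P w = V.haltProb P w .accept V.init := by
  simp only [acceptProb, haltProb, PMF.toOuterMeasure_eq_expect, expect_run]; rfl

lemma rejectProb_eq : V.rejectProb P w = V.haltProb P w .reject V.init := by
  simp only [rejectProb, haltProb, PMF.toOuterMeasure_eq_expect, expect_run]; rfl

variable {V} in
/-- The halting states. -/
def IsHalting (q : VerifierState V.R V.C) : Prop := q = .accept ∨ q = .reject

variable {V} in
lemma next_of_isHalting {c : V.Config} (hc : IsHalting c.state) (f : V.Config → ℝ≥0∞) :
    V.next P w f c = f c := by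
  obtain ⟨q, i, h⟩ := c
  rcases hc with hc | hc <;> obtain rfl : q = _ := hc <;>
    simp [next, step, PMF.expect_pure]

variable {V} in
lemma inState_le_next {q : VerifierState V.R V.C} (hq : IsHalting q) :
    V.inState q ≤ V.next P w (V.inState q) := by
  intro c
  by_cases hc : c.state = q
  · rw [next_of_isHalting P w (hc ▸ hq)]
  · simp [inState, hc]

variable {V} in
lemma monotone_iterate_inState {q : VerifierState V.R V.C} (hq : IsHalting q) :
    Monotone fun t => (V.next P w)^[t] (V.inState q) :=
  (V.next_mono P w).monotone_iterate_of_le_map (inState_le_next P w hq)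

variable {V} in
-- Dropping the first term of an increasing sequence keeps its supremum. This is the source of
-- harmonicity in `isValue_haltProb`.
lemma haltProb_eq_iSup_succ {q : VerifierState V.R V.C} (hq : IsHalting q) (c : V.Config) :
    V.haltProb P w q c = ⨆ t : ℕ, V.next P w ((V.next P w)^[t] (V.inState q)) c := by
  simp only [← Function.iterate_succ_apply' (V.next P w)]
  exact ((monotone_iterate_inState P w hq).apply₂ c).iSup_nat_add 1 |>.symm

lemma haltProb_le_one (q : VerifierState V.R V.C) (c : V.Config) : V.haltProb P w q c ≤ 1 := by
  refine iSup_le fun t => ?_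
  have h : (V.next P w)^[t] (V.inState q) ≤ (V.next P w)^[t] 1 :=
    (V.next_mono P w).iterate t (Set.indicator_le_self' fun _ _ => zero_le)
  rw [iterate_next_one] at h
  exact h c

variable {V} in
lemma haltProb_of_isHalting (q : VerifierState V.R V.C) {c : V.Config}
    (hc : IsHalting c.state) : V.haltProb P w q c = V.inState q c := by
  have h : ∀ t, (V.next P w)^[t] (V.inState q) c = V.inState q c := by
    intro t
    induction t with
    | zero => rfl
    | succ t ih => rw [Function.iterate_succ_apply', next_of_isHalting P w hc, ih]
  simp [haltProb, h]

/-- A function that exceeds its expectation after one step by at least `1` in every configuration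
that has not halted bounds the expected time. The set `S` is closed under steps. -/
lemma expectedTime_le (S : Set V.Config) (T : V.Config → ℝ≥0∞) (h0 : V.init ∈ S)
    (hS : ∀ c ∈ S, ∀ f g : V.Config → ℝ≥0∞, (∀ c ∈ S, f c ≤ g c) →
      V.next P w f c ≤ V.next P w g c)
    (hT : ∀ c ∈ S, ¬ IsHalting c.state → 1 + V.next P w T c ≤ T c) :
    V.expectedTime P w ≤ T V.init := by
  set r : V.Config → ℝ≥0∞ := Set.indicator {c | ¬ IsHalting c.state} 1 with hr
  have hrun : V.expectedTime P w = ∑' t, (V.next P w)^[t] r V.init := by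
    simp only [expectedTime, PMF.toOuterMeasure_eq_expect, expect_run, hr, IsHalting, not_or]
  have hpart : ∀ t, ∀ c ∈ S, ∑ s ∈ Finset.range t, (V.next P w)^[s] r c ≤ T c := by
    intro t
    induction t with
    | zero => simp
    | succ t ih =>
      intro c hc
      -- The terms at times `1, …, t` form the one-step expectation of the previous partial sum, so
      -- the induction hypothesis and the drift condition apply.
      have hsum : ∀ t, ∑ s ∈ Finset.range t, (V.next P w)^[s + 1] r c =
          V.next P w (fun c => ∑ s ∈ Finset.range t, (V.next P w)^[s] r c) c := by
        intro t
        induction t with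
        | zero =>
          simp only [Finset.range_zero, Finset.sum_empty]
          exact ((V.step P w c).expect_const 0).symm
        | succ t ih =>
          rw [Finset.sum_range_succ, ih, Function.iterate_succ_apply']
          simp only [Finset.sum_range_succ]
          exact (congrFun (V.next_add P w _ _) c).symm
      rw [Finset.sum_range_succ', hsum, Function.iterate_zero_apply]
      have hle := hS c hc _ _ ih
      by_cases hh : IsHalting c.state
      · have h2 : r c = 0 := by simp [hr, hh]
        rw [h2, add_zero]
        exact hle.trans (next_of_isHalting P w hh T).le
      · have h2 : r c = 1 := by simp [hr, hh]
        rw [h2, add_comm]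
        exact (add_le_add_right hle 1).trans (hT c hc hh)
  rw [hrun]
  exact ENNReal.tsum_le_of_sum_range_le fun t => hpart t _ h0

/-- If the expected time is finite, then the verifier halts with probability one. -/
lemma acceptProb_add_rejectProb (h : V.expectedTime P w ≠ ∞) :
    V.acceptProb P w + V.rejectProb P w = 1 := by
  set r : V.Config → ℝ≥0∞ := Set.indicator {c | ¬ IsHalting c.state} 1 with hr
  have hrun : V.expectedTime P w = ∑' t, (V.next P w)^[t] r V.init := by
    simp only [expectedTime, PMF.toOuterMeasure_eq_expect, expect_run, hr, IsHalting, not_or]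
  rw [hrun] at h
  have hlim := ENNReal.tendsto_atTop_zero_of_tsum_ne_top h
  have hsum : ∀ t, (V.next P w)^[t] (V.inState .accept) V.init +
      (V.next P w)^[t] (V.inState .reject) V.init + (V.next P w)^[t] r V.init = 1 := by
    intro t
    have h1 : V.inState .accept + V.inState .reject + r = 1 := by
      ext c
      obtain ⟨q, i, h⟩ := c
      cases q <;> simp [inState, hr, IsHalting]
    have h2 := V.iterate_next_one P w t
    rw [← h1, iterate_next_add, iterate_next_add] at h2
    exact congrFun h2 V.init |>.trans (congrFun h1 V.init)
  rw [acceptProb_eq, rejectProb_eq]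
  unfold haltProb
  have ha := tendsto_atTop_iSup
    ((monotone_iterate_inState P w (V := V) (q := .accept) (Or.inl rfl)).apply₂ V.init)
  have hb := tendsto_atTop_iSup
    ((monotone_iterate_inState P w (V := V) (q := .reject) (Or.inr rfl)).apply₂ V.init)
  have hall := (ha.add hb).add hlim
  rw [add_zero] at hall
  exact tendsto_nhds_unique hall (by simp only [hsum]; exact tendsto_const_nhds)

end TwoPFAVerifier

/-! ### The states and transitions of the verifier -/

namespace PowerVerifier

/-- The symbols of the certificate: two marks that should have the periods `n` and `n + 1`, where
`n` is the input length, and a mark that ends the blocks of a chain. -/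
structure Sym where
  first : Bool
  second : Bool
  chain : Bool

/-- The mark on the track of period `n` or `n + 1`. -/
def Sym.mark (u : Sym) : Bool → Bool
  | false => u.first
  | true => u.second

/-- Both period marks are present. -/
def Sym.both (u : Sym) : Bool := u.first && u.second

/-- What the verifier checks: one of the two periods; that the first block of the chain has the
length of the input; that a block is 64 times as long as the next one (`up` on the longer block,
`down` on the shorter one); the number of heads modulo `32 (n + 1)`. -/
inductive Mode
  | lap (d : Bool)
  | whole
  | up (j : ZMod 64)
  | down
  | cnt (s : ZMod 32)

/-- The reading states of the verifier. -/
inductive Control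
  | look (i : Fin 3)
  | pick (i : Fin 5)
  | ret (m : Mode)
  | walk (m : Mode)
  | act (m : Mode) (u : Sym)
  | check (m : Mode) (u : Sym)

instance : Finite Sym :=
  Finite.of_injective (fun u : Sym => (u.first, u.second, u.chain)) (by
    rintro ⟨a, b, c⟩ ⟨a', b', c'⟩ h
    simpa using h)

instance : Finite Mode := by
  have : Finite (ZMod 64) := Finite.of_fintype _
  have : Finite (ZMod 32) := Finite.of_fintype _
  let f : Bool ⊕ Bool ⊕ ZMod 64 ⊕ ZMod 32 → Mode
    | .inl d => .lap d
    | .inr (.inl false) => .whole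
    | .inr (.inl true) => .down
    | .inr (.inr (.inl j)) => .up j
    | .inr (.inr (.inr s)) => .cnt s
  refine Finite.of_surjective f ?_
  rintro (d | _ | j | _ | s)
  · exact ⟨.inl d, rfl⟩
  · exact ⟨.inr (.inl false), rfl⟩
  · exact ⟨.inr (.inr (.inl j)), rfl⟩
  · exact ⟨.inr (.inl true), rfl⟩
  · exact ⟨.inr (.inr (.inr s)), rfl⟩

instance : Finite Control := by
  let f : Fin 3 ⊕ Fin 5 ⊕ Mode ⊕ Mode ⊕ (Mode × Sym) ⊕ (Mode × Sym) → Control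
    | .inl i => .look i
    | .inr (.inl i) => .pick i
    | .inr (.inr (.inl m)) => .ret m
    | .inr (.inr (.inr (.inl m))) => .walk m
    | .inr (.inr (.inr (.inr (.inl (m, u))))) => .act m u
    | .inr (.inr (.inr (.inr (.inr (m, u))))) => .check m u
  refine Finite.of_surjective f ?_
  rintro (i | i | m | m | ⟨m, u⟩ | ⟨m, u⟩)
  · exact ⟨.inl i, rfl⟩
  · exact ⟨.inr (.inl i), rfl⟩
  · exact ⟨.inr (.inr (.inl m)), rfl⟩
  · exact ⟨.inr (.inr (.inr (.inl m))), rfl⟩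
  · exact ⟨.inr (.inr (.inr (.inr (.inl (m, u))))), rfl⟩
  · exact ⟨.inr (.inr (.inr (.inr (.inr (m, u))))), rfl⟩

/-- The states of the verifier. -/
abbrev St := VerifierState Control Mode

/-- The mode that the state `pick i` may choose. -/
def startMode : Fin 5 → Mode
  | 0 => .lap false
  | 1 => .lap true
  | 2 => .whole
  | 3 => .up 0
  | 4 => .cnt 0

/-- The head move at the beginning of a cycle. -/
def entryMove : Mode → HeadMove
  | .lap false => .right
  | .whole => .right
  | _ => .stay

/-- The reaction to a certificate symbol, given the scanned symbol and a coin toss. -/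
def react (m : Mode) (u : Sym) (x : TapeSymbol Unit) (b : Bool) : St × HeadMove :=
  match x, m with
  | .rightEnd, _ => (.reject, .stay)
  | _, .lap d => (.reading (.check (.lap d) u), .right)
  | _, .whole => (.reading (.check .whole u), .right)
  | x, .up j =>
    if u.chain then
      -- The mark belongs to the block, so the length is a multiple of 64 exactly when the counter
      -- shows 63. The move to the right accounts for the last group of 64.
      if j = 63 then (.communicating .down, .right)
      else match x with
        -- Head and counter are still at their initial values: the block has length one and the
        -- chain is complete.
        | .leftEnd => if j = 0 then (.accept, .stay) else (.reject, .stay)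
        | _ => (.reject, .stay)
    else (.communicating (.up (j + 1)), if j = 63 then .right else .stay)
  | .leftEnd, .down => (.reject, .stay)
  | _, .down => (.reading (.check .down u), .left)
  | _, .cnt s => (.reading (.check (.cnt s) u), if b then .right else .stay)

/-- The verdict on the number of completed passes. -/
def decision (s : ZMod 32) : St := if 16 ≤ s.val then .accept else .reject

/-- The check after the reaction to a certificate symbol. -/
def verdict (u : Sym) : Mode → TapeSymbol Unit → St
  | .lap d, .rightEnd =>
    if u.mark d then (if u.both then .accept else .reading (.ret (.lap d))) else .reject
  | .lap d, _ => if u.mark d then .reject else .communicating (.lap d)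
  | .whole, .rightEnd => if u.chain then .reading (.ret (.up 0)) else .reject
  | .whole, _ => if u.chain then .reject else .communicating .whole
  | .up _, _ => .reject
  | .down, .leftEnd => if u.chain then .reading (.ret (.up 0)) else .reject
  | .down, _ => if u.chain then .reject else .communicating .down
  | .cnt s, .rightEnd => if u.both then decision (s + 1) else .reading (.ret (.cnt (s + 1)))
  | .cnt s, _ => if u.both then decision s else .communicating (.cnt s)

/-- The next state and the head move, given the scanned symbol and a coin toss. -/
def outcome : Control → TapeSymbol Unit → Bool → St × HeadMove
  -- The states `look` reject the lengths 0 and 1; this excludes `64 ^ 0`, whose exponent is not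
  -- positive.
  | .look 0, _, _ => (.reading (.look 1), .right)
  | .look 1, .letter _, _ => (.reading (.look 2), .right)
  | .look 2, .letter _, _ => (.reading (.pick 0), .stay)
  | .look _, _, _ => (.reject, .stay)
  | .pick i, _, true => (.reading (.ret (startMode i)), .stay)
  | .pick i, _, false => (if i = 4 then .reject else .reading (.pick (i + 1)), .stay)
  | .ret m, .leftEnd, true => (.reading (.walk m), .right)
  | .ret m, .leftEnd, false => (.communicating m, entryMove m)
  | .ret m, _, _ => (.reading (.ret m), .left)
  | .walk m, .leftEnd, _ => (.communicating m, entryMove m)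
  | .walk m, .letter _, b => (.reading (.walk m), if b then .right else .left)
  | .walk _, .rightEnd, _ => (.reject, .stay)
  | .act m u, x, b => react m u x b
  | .check m u, x, _ => (verdict u m x, .stay)

/-- The bias of the coin that is tossed in a reading state. -/
noncomputable def bias (θ : unitInterval) : Control → unitInterval
  -- Successive biases 1/9, 1/8, …, 1/5 give each of the five modes probability 1/9 and leave 4/9
  -- for rejection.
  | .pick i => ⟨1 / (9 - (i : ℕ)), by
      have h : ((i : ℕ) : ℝ) ≤ 4 := by exact_mod_cast Nat.le_of_lt_succ i.2
      constructor
      · apply div_nonneg <;> linarith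
      · rw [div_le_one] <;> linarith⟩
  | .ret _ => ⟨1 / 64, by norm_num, by norm_num⟩
  | .walk _ => ⟨1 / 2, by norm_num, by norm_num⟩
  -- Among the remaining states only the reaction in mode `cnt` depends on the toss.
  | _ => θ

/-- The verifier for `UPOWER64`, whose counting coin has the bias `θ`. -/
noncomputable abbrev verifier (θ : unitInterval) : TwoPFAVerifier Unit where
  R := Control
  C := Mode
  U := Sym
  finite_R := inferInstance
  finite_C := inferInstance
  finite_U := inferInstance
  nonempty_U := ⟨⟨false, false, false⟩⟩
  start := .look 0
  readStep s x := (PMF.coin (bias θ s)).map (outcome s x)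
  message _ := ⟨false, false, false⟩
  commStep m u := .reading (.act m u)

/-- The configuration after `t` messages, all of which are equal. -/
noncomputable def conf (θ : unitInterval) (q : St) (h t : ℕ) : (verifier θ).Config :=
  ⟨q, h, List.replicate t ⟨false, false, false⟩⟩

/-- The certificate that a prover presents. -/
def certificate {θ : unitInterval} (P : (verifier θ).Prover) (w : List Unit) (t : ℕ) : Sym :=
  P w (List.replicate (t + 1) (⟨false, false, false⟩ : Sym))

/-! ### Acceptance and rejection probabilities as harmonic functions -/

section next

variable (θ : unitInterval) (P : (verifier θ).Prover) (w : List Unit)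
  (f : (verifier θ).Config → ℝ≥0∞)

lemma next_reading (s : Control) (h t : ℕ) :
    (verifier θ).next P w f (conf θ (.reading s) h t) =
      ENNReal.ofReal (bias θ s) * f (conf θ (outcome s (tapeSymbolAt w h) true).1
        (moveHead w h (outcome s (tapeSymbolAt w h) true).2) t) +
      ENNReal.ofReal (1 - bias θ s) * f (conf θ (outcome s (tapeSymbolAt w h) false).1
        (moveHead w h (outcome s (tapeSymbolAt w h) false).2) t) := by
  change (PMF.map _ (PMF.map _ (PMF.coin (bias θ s)))).expect f = _
  rw [PMF.expect_map, PMF.expect_map, PMF.expect_coin]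
  rfl

lemma next_communicating (m : Mode) (h t : ℕ) :
    (verifier θ).next P w f (conf θ (.communicating m) h t) =
      f (conf θ (.reading (.act m (certificate P w t))) h (t + 1)) := by
  change (PMF.pure _).expect f = _
  rw [PMF.expect_pure]
  unfold conf certificate
  rw [List.replicate_succ']

end next

/-- A bounded function on configurations that equals its expectation after one step and takes
the values `a` and `r` where the verifier has accepted and rejected; `σ` is the certificate. -/
structure IsValue (θ : unitInterval) (w : List Unit) (σ : ℕ → Sym) (a r : ℝ)
    (v : St → ℕ → ℕ → ℝ) : Prop where
  nonneg : ∀ q h t, 0 ≤ v q h t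
  le_one : ∀ q h t, v q h t ≤ 1
  accept : ∀ h t, v .accept h t = a
  reject : ∀ h t, v .reject h t = r
  communicating : ∀ m h t, v (.communicating m) h t = v (.reading (.act m (σ t))) h (t + 1)
  reading : ∀ s h t, v (.reading s) h t =
    bias θ s * v (outcome s (tapeSymbolAt w h) true).1
        (moveHead w h (outcome s (tapeSymbolAt w h) true).2) t +
      (1 - bias θ s) * v (outcome s (tapeSymbolAt w h) false).1
        (moveHead w h (outcome s (tapeSymbolAt w h) false).2) t

open TwoPFAVerifier in
-- Monotone convergence passes the one-step equation to the limit. Acceptance and rejection are both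
-- instances, so the same estimates serve soundness and completeness.
lemma isValue_haltProb (θ : unitInterval) (P : (verifier θ).Prover) (w : List Unit)
    {q : St} (hq : IsHalting (V := verifier θ) q) :
    IsValue θ w (certificate P w) ((verifier θ).inState q (conf θ .accept 0 0)).toReal
      ((verifier θ).inState q (conf θ .reject 0 0)).toReal
      fun s h t => ((verifier θ).haltProb P w q (conf θ s h t)).toReal where
  nonneg _ _ _ := ENNReal.toReal_nonneg
  le_one s h t := ENNReal.toReal_le_of_le_ofReal zero_le_one
    (by simpa using (verifier θ).haltProb_le_one P w q _)
  accept h t := by rw [haltProb_of_isHalting _ _ _ (Or.inl rfl)]; rfl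
  reject h t := by rw [haltProb_of_isHalting _ _ _ (Or.inr rfl)]; rfl
  communicating m h t := by
    rw [haltProb_eq_iSup_succ P w hq]
    simp only [next_communicating]
    rfl
  reading s h t := by
    have hne : ∀ c, (verifier θ).haltProb P w q c ≠ ∞ := fun c =>
      ne_top_of_le_ne_top ENNReal.one_ne_top ((verifier θ).haltProb_le_one P w q c)
    have hmono := monotone_iterate_inState P w hq
    rw [haltProb_eq_iSup_succ P w hq]
    simp only [next_reading]
    rw [← ENNReal.iSup_add_iSup_of_monotone
      (fun _ _ hab => mul_le_mul_right (hmono hab _) _)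
      (fun _ _ hab => mul_le_mul_right (hmono hab _) _),
      ← ENNReal.mul_iSup, ← ENNReal.mul_iSup]
    change (ENNReal.ofReal (bias θ s) * (verifier θ).haltProb P w q _ +
      ENNReal.ofReal (1 - bias θ s) * (verifier θ).haltProb P w q _).toReal = _
    rw [ENNReal.toReal_add (ENNReal.mul_ne_top ENNReal.ofReal_ne_top (hne _))
      (ENNReal.mul_ne_top ENNReal.ofReal_ne_top (hne _)), ENNReal.toReal_mul, ENNReal.toReal_mul,
      ENNReal.toReal_ofReal (bias θ s).2.1, ENNReal.toReal_ofReal (by linarith [(bias θ s).2.2])]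

open TwoPFAVerifier in
lemma isValue_acceptProb (θ : unitInterval) (P : (verifier θ).Prover) (w : List Unit) :
    IsValue θ w (certificate P w) 1 0
      fun s h t => ((verifier θ).haltProb P w .accept (conf θ s h t)).toReal := by
  have h := isValue_haltProb θ P w (q := .accept) (Or.inl rfl)
  have h1 : (verifier θ).inState .accept (conf θ .accept 0 0) = 1 := 
    Set.indicator_of_mem (by simp [conf]) _
  have h2 : (verifier θ).inState .accept (conf θ .reject 0 0) = 0 :=
    Set.indicator_of_notMem (by simp [conf]) _
  rw [h1, h2] at h
  simpa using h

open TwoPFAVerifier in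
lemma isValue_rejectProb (θ : unitInterval) (P : (verifier θ).Prover) (w : List Unit) :
    IsValue θ w (certificate P w) 0 1
      fun s h t => ((verifier θ).haltProb P w .reject (conf θ s h t)).toReal := by
  have h := isValue_haltProb θ P w (q := .reject) (Or.inr rfl)
  have h1 : (verifier θ).inState .reject (conf θ .reject 0 0) = 1 := 
    Set.indicator_of_mem (by simp [conf]) _
  have h2 : (verifier θ).inState .reject (conf θ .accept 0 0) = 0 :=
    Set.indicator_of_notMem (by simp [conf]) _
  rw [h1, h2] at h
  simpa using h

end PowerVerifier

/-! ### Tape cells, affine functions and scans for a mark -/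

lemma tapeSymbolAt_letter {w : List Unit} {h : ℕ} (h0 : h ≠ 0) (hw : h ≤ w.length) :
    tapeSymbolAt w h = .letter () := by
  obtain ⟨i, rfl⟩ := Nat.exists_eq_succ_of_ne_zero h0
  have hi : i < w.length := hw
  simp [tapeSymbolAt, hi]

lemma tapeSymbolAt_rightEnd {w : List Unit} {h : ℕ} (hw : w.length < h) :
    tapeSymbolAt w h = .rightEnd := by
  obtain ⟨i, rfl⟩ := Nat.exists_eq_succ_of_ne_zero (Nat.ne_zero_of_lt hw)
  have hi : w.length ≤ i := Nat.le_of_lt_succ hw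
  simp [tapeSymbolAt, hi]

lemma tapeSymbolAt_ne_rightEnd {w : List Unit} {h : ℕ} (hw : h ≤ w.length) :
    tapeSymbolAt w h ≠ .rightEnd := by
  rcases Nat.eq_zero_or_pos h with rfl | h0
  · simp [tapeSymbolAt]
  · simp [tapeSymbolAt_letter h0.ne' hw]

lemma tapeSymbolAt_ne_leftEnd {w : List Unit} {h : ℕ} (h0 : h ≠ 0) :
    tapeSymbolAt w h ≠ .leftEnd := by
  rcases le_or_gt h w.length with hw | hw
  · simp [tapeSymbolAt_letter h0 hw]
  · simp [tapeSymbolAt_rightEnd hw]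

lemma moveHead_right {A : Type} {w : List A} {h : ℕ} (hw : h ≤ w.length) :
    moveHead w h .right = h + 1 := by
  simp [moveHead, hw]

/-- A function that is harmonic in the interior of an interval is affine. -/
lemma affine_of_midpoint {f : ℕ → ℝ} {n : ℕ}
    (hf : ∀ h, h < n → f (h + 1) = (f (h + 2) + f h) / 2) :
    ∀ h ≤ n + 1, f h = f 0 + h * (f 1 - f 0) := by
  have hd : ∀ h ≤ n, f (h + 1) - f h = f 1 - f 0 := by
    intro h
    induction h with
    | zero => simp
    | succ h ih =>
      intro hh
      have := hf h hh
      have := ih (by omega)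
      linarith
  intro h
  induction h with
  | zero => simp
  | succ h ih =>
    intro hh
    have := hd h (by omega)
    have := ih (by omega)
    push_cast
    linarith

/-- A scan for a mark that leads to the value `r` if the mark appears too early. -/
lemma scan_eq {g : ℕ → ℝ} {μ : ℕ → Bool} {r : ℝ} {j : ℕ}
    (hg : ∀ i < j, g i = if μ i then r else g (i + 1)) (hμ : ∀ i < j, μ i = false) :
    g 0 = g j := by
  induction j with
  | zero => rfl
  | succ j ih =>
    rw [ih (fun i hi => hg i (by omega)) (fun i hi => hμ i (by omega)), hg j (by omega),
      hμ j (by omega)]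
    simp

/-- A first mark met during the scan would make the initial value zero. In this way a positive
acceptance probability forces properties of the certificate. -/
lemma scan_unmarked {g : ℕ → ℝ} {μ : ℕ → Bool} {j : ℕ}
    (hg : ∀ i < j, g i = if μ i then 0 else g (i + 1)) (h0 : 0 < g 0) :
    ∀ i < j, μ i = false := by
  induction j with
  | zero => simp
  | succ j ih =>
    have hj := ih (fun i hi => hg i (by omega))
    intro i hi
    rcases Nat.lt_succ_iff_lt_or_eq.1 hi with h | rfl
    · exact hj i h
    · by_contra hne
      rw [scan_eq (fun i hi => hg i (by omega)) hj, hg i (by omega)] at h0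
      simp [hne] at h0

/-! ### The random walk between two cycles -/

namespace PowerVerifier

/-- The position in which the first certificate symbol of a cycle is read. -/
def entryPos : Mode → ℕ
  | .lap false => 1
  | .whole => 1
  | _ => 0

lemma moveHead_entryMove (w : List Unit) (m : Mode) :
    moveHead w 0 (entryMove m) = entryPos m := by
  rcases m with (_ | _) | _ | _ | _ | _ <;> simp [moveHead, entryMove, entryPos]

/-- The probability that the verifier gives up between two cycles. -/
noncomputable def lapse (n : ℕ) : ℝ := 1 / (64 * (n + 1))

lemma lapse_pos (n : ℕ) : 0 < lapse n := by unfold lapse; positivity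

lemma lapse_lt_one (n : ℕ) : lapse n < 1 := by
  unfold lapse
  rw [div_lt_one (by positivity)]
  have : (0 : ℝ) ≤ n := n.cast_nonneg
  linarith

namespace IsValue

variable {θ : unitInterval} {w : List Unit} {σ : ℕ → Sym} {a r : ℝ} {v : St → ℕ → ℕ → ℝ}

lemma reading_eq (hv : IsValue θ w σ a r v) {s : Control} {h t : ℕ} {o : St × HeadMove}
    (ho : ∀ b, outcome s (tapeSymbolAt w h) b = o) :
    v (.reading s) h t = v o.1 (moveHead w h o.2) t := by
  rw [hv.reading, ho, ho]
  ring

lemma ret_succ (hv : IsValue θ w σ a r v) (m : Mode) (h t : ℕ) :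
    v (.reading (.ret m)) (h + 1) t = v (.reading (.ret m)) h t := by
  rw [hv.reading_eq (o := (.reading (.ret m), .left))]
  · rfl
  · intro b
    rcases hx : tapeSymbolAt w (h + 1) with _ | _ | _
    · exact absurd hx (tapeSymbolAt_ne_leftEnd (by omega))
    · rfl
    · rfl

lemma ret_eq (hv : IsValue θ w σ a r v) (m : Mode) (h t : ℕ) :
    v (.reading (.ret m)) h t = v (.reading (.ret m)) 0 t := by
  induction h with
  | zero => rfl
  | succ h ih => rw [hv.ret_succ, ih]

lemma walk_zero (hv : IsValue θ w σ a r v) (m : Mode) (t : ℕ) :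
    v (.reading (.walk m)) 0 t = v (.communicating m) (entryPos m) t := by
  rw [hv.reading_eq (o := (.communicating m, entryMove m)) (fun _ => rfl), moveHead_entryMove]

/-- Gambler's ruin: the value is harmonic between the end-markers, hence affine in the position, and
cell 1 lies one `(n + 1)`-th of the way to the rejecting end. -/
lemma walk_one (hv : IsValue θ w σ a r v) (m : Mode) (t : ℕ) :
    (w.length + 1) * v (.reading (.walk m)) 1 t =
      w.length * v (.communicating m) (entryPos m) t + r := by
  have hend : v (.reading (.walk m)) (w.length + 1) t = r := by
    rw [hv.reading_eq (o := (.reject, .stay)), hv.reject]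
    intro b
    rw [tapeSymbolAt_rightEnd (by omega)]
    rfl
  have hmid : ∀ h, h < w.length → v (.reading (.walk m)) (h + 1) t =
      (v (.reading (.walk m)) (h + 2) t + v (.reading (.walk m)) h t) / 2 := by
    intro h hh
    rw [hv.reading, tapeSymbolAt_letter (by omega) (by omega)]
    simp only [outcome, if_true, Bool.false_eq_true, if_false, bias,
      moveHead_right (show h + 1 ≤ w.length by omega)]
    simp only [moveHead, Nat.add_sub_cancel]
    ring
  have haff := affine_of_midpoint (f := fun h => v (.reading (.walk m)) h t) hmid
    (w.length + 1) le_rfl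
  simp only [hend, hv.walk_zero] at haff
  push_cast at haff
  linarith

/-- The value at the end of a cycle. -/
lemma cycle (hv : IsValue θ w σ a r v) (m : Mode) (h t : ℕ) :
    v (.reading (.ret m)) h t =
      (1 - lapse w.length) * v (.communicating m) (entryPos m) t + lapse w.length * r := by
  rw [hv.ret_eq, hv.reading]
  have h1 := hv.walk_one m t
  have hpos : (0 : ℝ) < w.length + 1 := by positivity
  have h2 : v (.reading (.walk m)) 1 t =
      (w.length * v (.communicating m) (entryPos m) t + r) / (w.length + 1) := by
    rw [eq_div_iff hpos.ne', ← h1]; ring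
  change 1 / 64 * v (.reading (.walk m)) (moveHead w 0 .right) t +
    (1 - 1 / 64) * v (.communicating m) (moveHead w 0 (entryMove m)) t = _
  rw [moveHead_right (Nat.zero_le _), moveHead_entryMove, h2]
  unfold lapse
  field_simp
  ring

lemma cycle_le (hv : IsValue θ w σ a r v) (hr : r ≤ 1) (m : Mode) (h t : ℕ) :
    v (.reading (.ret m)) h t ≤ v (.communicating m) (entryPos m) t + lapse w.length := by
  rw [hv.cycle]
  nlinarith [hv.nonneg (.communicating m) (entryPos m) t, lapse_pos w.length]

lemma cycle_zero (hv : IsValue θ w σ a 0 v) (m : Mode) (h t : ℕ) :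
    v (.reading (.ret m)) h t =
      (1 - lapse w.length) * v (.communicating m) (entryPos m) t := by
  rw [hv.cycle]
  ring

lemma init_of_length_le_one (hv : IsValue θ w σ a r v) (hw : w.length ≤ 1) :
    v (.reading (.look 0)) 0 0 = r := by
  rw [hv.reading_eq (o := (.reading (.look 1), .right)) (fun _ => rfl),
    moveHead_right (Nat.zero_le _)]
  rcases Nat.eq_zero_or_pos w.length with h0 | h0
  · rw [hv.reading_eq (o := (.reject, .stay)), hv.reject]
    intro b
    rw [tapeSymbolAt_rightEnd (by omega)]
    rfl
  · rw [hv.reading_eq (o := (.reading (.look 2), .right)), moveHead_right (by omega)]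
    · rw [hv.reading_eq (o := (.reject, .stay)), hv.reject]
      intro b
      rw [tapeSymbolAt_rightEnd (by omega)]
      rfl
    · intro b
      rw [tapeSymbolAt_letter (by omega) (by omega)]
      rfl

lemma init_eq (hv : IsValue θ w σ a r v) (hw : 2 ≤ w.length) :
    v (.reading (.look 0)) 0 0 = (v (.reading (.ret (.lap false))) 0 0 +
      v (.reading (.ret (.lap true))) 0 0 + v (.reading (.ret .whole)) 0 0 +
      v (.reading (.ret (.up 0))) 0 0 + v (.reading (.ret (.cnt 0))) 0 0 + 4 * r) / 9 := by
  rw [hv.reading_eq (o := (.reading (.look 1), .right)) (fun _ => rfl),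
    moveHead_right (Nat.zero_le _), hv.reading_eq (o := (.reading (.look 2), .right)),
    moveHead_right (by omega), hv.reading_eq (o := (.reading (.pick 0), .stay))]
  · have hp : ∀ i : Fin 5, v (.reading (.pick i)) 2 0 =
        1 / (9 - (i : ℕ)) * v (.reading (.ret (startMode i))) 0 0 +
        (1 - 1 / (9 - (i : ℕ))) *
          v (if i = 4 then .reject else .reading (.pick (i + 1))) 2 0 := by
      intro i
      rw [hv.reading, ← hv.ret_eq _ 2]
      rfl
    have h0 := hp 0
    have h1 := hp 1
    have h2 := hp 2
    have h3 := hp 3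
    have h4 := hp 4
    simp only [startMode, hv.reject, Fin.reduceEq, if_true, if_false, Fin.reduceAdd] at h0 h1 h2 h3 h4
    norm_num at h0 h1 h2 h3 h4
    change v (.reading (.pick 0)) 2 0 = _
    linarith
  · intro b
    rw [tapeSymbolAt_letter (by omega) (by omega)]
    rfl
  · intro b
    rw [tapeSymbolAt_letter (by omega) (by omega)]
    rfl

end IsValue
end PowerVerifier

/-! ### The period checks and the first block -/

namespace PowerVerifier

/-- The period that the mode `lap d` checks. -/
def period (n : ℕ) (d : Bool) : ℕ := if d then n + 1 else n

/-- A lap of period `n` enters one cell later than one of period `n + 1`, so both end exactly at the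
right end-marker. -/
lemma entryPos_add_period (n : ℕ) (d : Bool) : entryPos (.lap d) + period n d = n + 1 := by
  cases d <;> simp [entryPos, period, add_comm]

/-- A block of the chain: `D` symbols from position `t` on, of which the last one is marked. -/
def IsBlock (σ : ℕ → Sym) (t D : ℕ) : Prop :=
  ∃ E, D = E + 1 ∧ (∀ i < E, (σ (t + i)).chain = false) ∧ (σ (t + E)).chain = true

lemma IsBlock.unique {σ : ℕ → Sym} {t D D' : ℕ} (h : IsBlock σ t D) (h' : IsBlock σ t D') :
    D = D' := by
  obtain ⟨E, rfl, h1, h2⟩ := h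
  obtain ⟨E', rfl, h1', h2'⟩ := h'
  rcases lt_trichotomy E E' with h | h | h
  · simp [h1' E h] at h2
  · rw [h]
  · simp [h1 E' h] at h2'

namespace IsValue

variable {θ : unitInterval} {w : List Unit} {σ : ℕ → Sym} {a r : ℝ} {v : St → ℕ → ℕ → ℝ}

lemma sweep_step (hv : IsValue θ w σ a r v) {m : Mode} (hm : m = .whole ∨ ∃ d, m = .lap d)
    {h : ℕ} (hw : h ≤ w.length) (t : ℕ) :
    v (.communicating m) h t = v (.reading (.check m (σ t))) (h + 1) (t + 1) := by
  rw [hv.communicating, hv.reading_eq (o := (.reading (.check m (σ t)), .right)),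
    moveHead_right hw]
  intro b
  have hne := tapeSymbolAt_ne_rightEnd hw
  rcases hm with rfl | ⟨d, rfl⟩ <;> rcases hx : tapeSymbolAt w h with _ | _ | _ <;>
    first | exact absurd hx hne | rfl

lemma check_eq (hv : IsValue θ w σ a r v) (m : Mode) (u : Sym) (h t : ℕ) :
    v (.reading (.check m u)) h t = v (verdict u m (tapeSymbolAt w h)) h t :=
  hv.reading_eq (o := (verdict u m (tapeSymbolAt w h), .stay)) fun _ => rfl

lemma lap_step (hv : IsValue θ w σ a r v) (d : Bool) {h : ℕ} (hw : h < w.length) (t : ℕ) :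
    v (.communicating (.lap d)) h t =
      if (σ t).mark d then r else v (.communicating (.lap d)) (h + 1) (t + 1) := by
  rw [hv.sweep_step (Or.inr ⟨d, rfl⟩) hw.le, hv.check_eq,
    tapeSymbolAt_letter (by omega) (by omega)]
  simp only [verdict]
  split_ifs <;> simp [hv.reject]

lemma lap_last (hv : IsValue θ w σ a r v) (d : Bool) (t : ℕ) :
    v (.communicating (.lap d)) w.length t =
      if (σ t).mark d then if (σ t).both then a
        else v (.reading (.ret (.lap d))) 0 (t + 1) else r := by
  rw [hv.sweep_step (Or.inr ⟨d, rfl⟩) le_rfl, hv.check_eq, tapeSymbolAt_rightEnd (by omega)]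
  simp only [verdict]
  split_ifs <;> simp [hv.reject, hv.accept, hv.ret_eq _ (w.length + 1)]

lemma whole_step (hv : IsValue θ w σ a r v) {h : ℕ} (hw : h < w.length) (t : ℕ) :
    v (.communicating .whole) h t =
      if (σ t).chain then r else v (.communicating .whole) (h + 1) (t + 1) := by
  rw [hv.sweep_step (Or.inl rfl) hw.le, hv.check_eq, tapeSymbolAt_letter (by omega) (by omega)]
  simp only [verdict]
  split_ifs <;> simp [hv.reject]

lemma whole_last (hv : IsValue θ w σ a r v) (t : ℕ) :
    v (.communicating .whole) w.length t =
      if (σ t).chain then v (.reading (.ret (.up 0))) 0 (t + 1) else r := by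
  rw [hv.sweep_step (Or.inl rfl) le_rfl, hv.check_eq, tapeSymbolAt_rightEnd (by omega)]
  simp only [verdict]
  split_ifs <;> simp [hv.reject, hv.ret_eq _ (w.length + 1)]

lemma lap_scan (hv : IsValue θ w σ a r v) (d : Bool) (t : ℕ) :
    ∀ i < period w.length d - 1,
      v (.communicating (.lap d)) (entryPos (.lap d) + i) (t + i) =
        if (σ (t + i)).mark d then r
        else v (.communicating (.lap d)) (entryPos (.lap d) + (i + 1)) (t + (i + 1)) := by
  intro i hi
  have := entryPos_add_period w.length d
  rw [hv.lap_step d (by omega)]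
  simp only [add_assoc]

lemma lap_eq (hv : IsValue θ w σ a r v) (hw : 0 < w.length) (d : Bool) (t : ℕ)
    (hμ : ∀ i < period w.length d - 1, (σ (t + i)).mark d = false) :
    v (.communicating (.lap d)) (entryPos (.lap d)) t =
      if (σ (t + (period w.length d - 1))).mark d then
        if (σ (t + (period w.length d - 1))).both then a
        else v (.reading (.ret (.lap d))) 0 (t + period w.length d) else r := by
  have hp := entryPos_add_period w.length d
  have hp1 : 1 ≤ period w.length d := by unfold period; split_ifs <;> omega
  have h1 := scan_eq (hv.lap_scan d t) hμ
  simp only [add_zero] at h1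
  rw [h1, show entryPos (.lap d) + (period w.length d - 1) = w.length by omega, hv.lap_last,
    show t + (period w.length d - 1) + 1 = t + period w.length d by omega]

lemma lap_unmarked (hv : IsValue θ w σ a 0 v) (d : Bool) (t : ℕ)
    (h0 : 0 < v (.communicating (.lap d)) (entryPos (.lap d)) t) :
    ∀ i < period w.length d - 1, (σ (t + i)).mark d = false :=
  scan_unmarked (g := fun i => v (.communicating (.lap d)) (entryPos (.lap d) + i) (t + i))
    (μ := fun i => (σ (t + i)).mark d) (hv.lap_scan d t) h0

/-- If a period check may accept, then the marks have the right period until both coincide. -/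
lemma lap_sound (hv : IsValue θ w σ a 0 v) (hw : 0 < w.length) (d : Bool)
    (h0 : 0 < v (.communicating (.lap d)) (entryPos (.lap d)) 0) :
    ∃ T, (∀ i ≤ T, (σ i).mark d = true ↔ period w.length d ∣ i + 1) ∧ (σ T).both = true ∧
      ∀ i < T, (σ i).both = false := by
  set p := period w.length d with hp
  have hp1 : 1 ≤ p := by rw [hp]; unfold period; split_ifs <;> omega
  set x := v (.communicating (.lap d)) (entryPos (.lap d)) 0 with hx
  by_contra hcon
  -- Every lap without coincidence has correct marks and costs a factor `1 - lapse`. If no lap ended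
  -- the check, the positive number `x` would lie below all powers of this factor.
  have key : ∀ j, (∀ i < j * p, ((σ i).mark d = true ↔ p ∣ i + 1) ∧ (σ i).both = false) ∧
      x ≤ (1 - lapse w.length) ^ j * v (.communicating (.lap d)) (entryPos (.lap d)) (j * p) := by
    intro j
    induction j with
    | zero => simp [hx]
    | succ j ih =>
      obtain ⟨ih1, ih2⟩ := ih
      have hpos : 0 < v (.communicating (.lap d)) (entryPos (.lap d)) (j * p) := by
        by_contra hle
        have h1 : v (.communicating (.lap d)) (entryPos (.lap d)) (j * p) = 0 :=
          le_antisymm (not_lt.1 hle) (hv.nonneg _ _ _)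
        rw [h1, mul_zero] at ih2
        exact absurd h0 (not_lt.2 ih2)
      have hun := hv.lap_unmarked d (j * p) hpos
      have heq := hv.lap_eq hw d (j * p) hun
      rw [← hp] at heq hun
      have hmark : (σ (j * p + (p - 1))).mark d = true := by
        by_contra hm
        rw [heq] at hpos
        simp [hm] at hpos
      have hdiv : ∀ i, j * p ≤ i → i < (j + 1) * p → ((σ i).mark d = true ↔ p ∣ i + 1) := by
        intro i hi1 hi2
        obtain ⟨e, rfl⟩ := Nat.exists_eq_add_of_le hi1
        have he : e < p := by rw [add_mul] at hi2; omega
        rw [add_assoc, Nat.dvd_add_right (Dvd.intro_left j rfl)]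
        rcases Nat.lt_or_ge e (p - 1) with h | h
        · simp only [hun e h, Bool.false_eq_true, false_iff]
          exact Nat.not_dvd_of_pos_of_lt (by omega) (by omega)
        · obtain rfl : e = p - 1 := by omega
          simp [hmark, Nat.sub_add_cancel hp1]
      have hall : ∀ i < (j + 1) * p, ((σ i).mark d = true ↔ p ∣ i + 1) := by
        intro i hi
        rcases Nat.lt_or_ge i (j * p) with h | h
        · exact (ih1 i h).1
        · exact hdiv i h hi
      have hlast : (j + 1) * p = j * p + (p - 1) + 1 := by rw [add_mul]; omega
      have hbefore : ∀ i < j * p + (p - 1), (σ i).both = false := by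
        intro i hi
        rcases Nat.lt_or_ge i (j * p) with h | h
        · exact (ih1 i h).2
        · obtain ⟨e, rfl⟩ := Nat.exists_eq_add_of_le h
          have := hun e (by omega)
          cases d <;> simp only [Sym.mark] at this <;> simp [Sym.both, this]
      have hnb : (σ (j * p + (p - 1))).both = false := by
        by_contra hb
        exact hcon ⟨j * p + (p - 1), fun i hi => hall i (by omega), by simpa using hb, hbefore⟩
      refine ⟨fun i hi => ⟨hall i hi, ?_⟩, ?_⟩
      · rcases Nat.lt_or_ge i (j * p + (p - 1)) with h | h
        · exact hbefore i h
        · rwa [show i = j * p + (p - 1) by omega]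
      · rw [heq, if_pos hmark, if_neg (by simp [hnb]), hv.cycle_zero] at ih2
        rw [show (j + 1) * p = j * p + p by ring, pow_succ, mul_assoc]
        exact ih2
  have hl0 : 0 ≤ 1 - lapse w.length := by linarith [lapse_lt_one w.length]
  obtain ⟨j, hj⟩ := exists_pow_lt_of_lt_one h0
    (show 1 - lapse w.length < 1 by linarith [lapse_pos w.length])
  have h1 := (key j).2
  have h2 := hv.le_one (.communicating (.lap d)) (entryPos (.lap d)) (j * p)
  have h3 := pow_nonneg hl0 j
  nlinarith

/-- Induction on the number of laps: only the `k` transitions between the `k + 1` laps can fail,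
each with probability `lapse`. -/
lemma lap_complete (hv : IsValue θ w σ 0 1 v) (hw : 0 < w.length) (d : Bool) (k t : ℕ)
    (hμ : ∀ i < (k + 1) * period w.length d,
      ((σ (t + i)).mark d = true ↔ period w.length d ∣ i + 1))
    (hb : (σ (t + ((k + 1) * period w.length d - 1))).both = true) :
    v (.communicating (.lap d)) (entryPos (.lap d)) t ≤ k * lapse w.length := by
  set p := period w.length d with hp
  have hp1 : 1 ≤ p := by rw [hp]; unfold period; split_ifs <;> omega
  induction k generalizing t with
  | zero =>
    rw [hv.lap_eq hw d t, ← hp]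
    · have hm : (σ (t + (p - 1))).mark d = true := by
        rw [hμ _ (by omega), Nat.sub_add_cancel hp1]
      have hb' : (σ (t + (p - 1))).both = true := by simpa using hb
      simp [hm, hb']
    · intro i hi
      rw [← Bool.not_eq_true, hμ i (by omega)]
      exact Nat.not_dvd_of_pos_of_lt (by omega) (by omega)
  | succ k ih =>
    rw [hv.lap_eq hw d t, ← hp]
    · have hm : (σ (t + (p - 1))).mark d = true := by
        rw [hμ _ (by nlinarith [Nat.sub_add_cancel hp1]), Nat.sub_add_cancel hp1]
      rw [if_pos hm]
      push_cast
      have hl := lapse_pos w.length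
      split_ifs
      -- A coincidence before the last lap would lead to acceptance, which has value 0 here.
      · positivity
      · have h1 := hv.cycle_le le_rfl (.lap d) 0 (t + p)
        have h2 := ih (t + p) (fun i hi => by
          rw [add_assoc, hμ (p + i) (by nlinarith), add_assoc, Nat.dvd_add_right dvd_rfl]) (by
          rwa [show t + p + ((k + 1) * p - 1) = t + ((k + 1 + 1) * p - 1) by
            have : 1 ≤ (k + 1) * p := by nlinarith
            rw [add_mul (k + 1)]; omega])
        linarith
    · intro i hi
      rw [← Bool.not_eq_true, hμ i (by nlinarith [Nat.sub_add_cancel hp1])]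
      exact Nat.not_dvd_of_pos_of_lt (by omega) (by omega)

lemma whole_scan (hv : IsValue θ w σ a r v) (t : ℕ) : ∀ i < w.length - 1,
    v (.communicating .whole) (1 + i) (t + i) =
      if (σ (t + i)).chain then r
      else v (.communicating .whole) (1 + (i + 1)) (t + (i + 1)) := by
  intro i hi
  rw [hv.whole_step (by omega)]
  simp only [add_assoc]

lemma whole_eq (hv : IsValue θ w σ a r v) (hb : IsBlock σ 0 w.length) :
    v (.communicating .whole) (entryPos .whole) 0 =
      v (.reading (.ret (.up 0))) 0 w.length := by
  obtain ⟨E, hE, h1, h2⟩ := hb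
  have h3 := scan_eq (hv.whole_scan 0) (fun i hi => h1 i (by omega))
  simp only [add_zero] at h3
  rw [show entryPos .whole = 1 from rfl, h3, show 1 + (w.length - 1) = w.length by omega,
    hv.whole_last, show 0 + (w.length - 1) = 0 + E by omega, if_pos h2, hE, zero_add]

lemma whole_sound (hv : IsValue θ w σ a 0 v) (hw : 0 < w.length)
    (h0 : 0 < v (.communicating .whole) (entryPos .whole) 0) :
    IsBlock σ 0 w.length := by
  refine ⟨w.length - 1, by omega, scan_unmarked (hv.whole_scan 0) h0, ?_⟩
  have h3 := scan_eq (hv.whole_scan 0) (scan_unmarked (hv.whole_scan 0) h0)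
  simp only [add_zero] at h3
  by_contra hne
  rw [show entryPos .whole = 1 from rfl, h3, show 1 + (w.length - 1) = w.length by omega,
    hv.whole_last, if_neg hne] at h0
  exact lt_irrefl _ h0

end IsValue
end PowerVerifier

/-! ### The chain of blocks -/

lemma ZMod.natCast_eq_sixtyThree_iff (E : ℕ) : (E : ZMod 64) = 63 ↔ E % 64 = 63 := by
  rw [show (63 : ZMod 64) = ((63 : ℕ) : ZMod 64) by rfl, ZMod.natCast_eq_natCast_iff']

namespace PowerVerifier.IsValue

variable {θ : unitInterval} {w : List Unit} {σ : ℕ → Sym} {a r : ℝ} {v : St → ℕ → ℕ → ℝ}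

lemma overflow (hv : IsValue θ w σ a r v) (m : Mode) {h : ℕ} (hw : w.length < h) (t : ℕ) :
    v (.communicating m) h t = r := by
  rw [hv.communicating, hv.reading_eq (o := (.reject, .stay)), hv.reject]
  intro b
  rw [tapeSymbolAt_rightEnd hw]
  rfl

lemma up_unmarked (hv : IsValue θ w σ a r v) (j : ZMod 64) {h : ℕ} (hw : h ≤ w.length) {t : ℕ}
    (hc : (σ t).chain = false) : v (.communicating (.up j)) h t =
      v (.communicating (.up (j + 1))) (if j = 63 then h + 1 else h) (t + 1) := by
  rw [hv.communicating, hv.reading_eq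
    (o := (.communicating (.up (j + 1)), if j = 63 then .right else .stay))]
  · split_ifs
    · rw [moveHead_right hw]
    · rfl
  · intro b
    have hne := tapeSymbolAt_ne_rightEnd hw
    rcases hx : tapeSymbolAt w h with _ | _ | _ <;>
      first | exact absurd hx hne | simp [outcome, react, hc]

lemma up_turn (hv : IsValue θ w σ a r v) {h : ℕ} (hw : h ≤ w.length) {t : ℕ}
    (hc : (σ t).chain = true) : v (.communicating (.up 63)) h t =
      v (.communicating .down) (h + 1) (t + 1) := by
  rw [hv.communicating, hv.reading_eq (o := (.communicating .down, .right)), moveHead_right hw]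
  intro b
  have hne := tapeSymbolAt_ne_rightEnd hw
  rcases hx : tapeSymbolAt w h with _ | _ | _ <;>
    first | exact absurd hx hne | simp [outcome, react, hc]

lemma up_one (hv : IsValue θ w σ a r v) {t : ℕ} (hc : (σ t).chain = true) :
    v (.communicating (.up 0)) 0 t = a := by
  rw [hv.communicating, hv.reading_eq (o := (.accept, .stay)), hv.accept]
  intro b
  have : (0 : ZMod 64) ≠ 63 := by decide
  simp [outcome, react, hc, tapeSymbolAt, this]

lemma up_fail (hv : IsValue θ w σ a r v) {j : ZMod 64} (hj : j ≠ 63) {h : ℕ}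
    (hne : h ≠ 0 ∨ j ≠ 0) {t : ℕ} (hc : (σ t).chain = true) :
    v (.communicating (.up j)) h t = r := by
  rw [hv.communicating, hv.reading_eq (o := (.reject, .stay)), hv.reject]
  intro b
  rcases hx : tapeSymbolAt w h with _ | _ | _
  · have h0 : h = 0 := by
      by_contra h0
      exact tapeSymbolAt_ne_leftEnd h0 hx
    have : j ≠ 0 := by tauto
    simp [outcome, react, hc, hj, this]
  · simp [outcome, react, hc, hj]
  · rfl

/-- Counter and head position store `E` as remainder and quotient modulo 64. The bound on `E` keeps
the head off the right end-marker while symbols are read. -/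
lemma up_run (hv : IsValue θ w σ a r v) (t E : ℕ) (hE : E ≤ 64 * (w.length + 1))
    (hc : ∀ i < E, (σ (t + i)).chain = false) :
    v (.communicating (.up 0)) 0 t = v (.communicating (.up E)) (E / 64) (t + E) := by
  induction E with
  | zero => simp
  | succ E ih =>
    rw [ih (by omega) (fun i hi => hc i (by omega)), hv.up_unmarked _ (by omega) (hc E (by omega)),
      Nat.cast_succ]
    simp only [ZMod.natCast_eq_sixtyThree_iff]
    congr 1
    split_ifs <;> omega

lemma down_eq (hv : IsValue θ w σ a r v) {h : ℕ} (hw : h < w.length) (t : ℕ) :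
    v (.communicating .down) (h + 1) t = v (.reading (.check .down (σ t))) h (t + 1) := by
  rw [hv.communicating, hv.reading_eq (o := (.reading (.check .down (σ t)), .left))]
  · rfl
  · intro b
    rw [tapeSymbolAt_letter (by omega) (by omega)]
    rfl

lemma down_step (hv : IsValue θ w σ a r v) {h : ℕ} (h0 : 0 < h) (hw : h < w.length) (t : ℕ) :
    v (.communicating .down) (h + 1) t =
      if (σ t).chain then r else v (.communicating .down) h (t + 1) := by
  rw [hv.down_eq hw, hv.check_eq, tapeSymbolAt_letter h0.ne' hw.le]
  simp only [verdict]
  split_ifs <;> simp [hv.reject]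

lemma down_last (hv : IsValue θ w σ a r v) (hw : 0 < w.length) (t : ℕ) :
    v (.communicating .down) 1 t =
      if (σ t).chain then v (.reading (.ret (.up 0))) 0 (t + 1) else r := by
  rw [hv.down_eq hw, hv.check_eq]
  simp only [verdict, tapeSymbolAt]
  split_ifs <;> simp [hv.reject]

lemma down_scan (hv : IsValue θ w σ a r v) {D : ℕ} (hD : D ≤ w.length) (t : ℕ) :
    ∀ i < D - 1, v (.communicating .down) (D - i) (t + i) =
      if (σ (t + i)).chain then r else v (.communicating .down) (D - (i + 1)) (t + (i + 1)) := by
  intro i hi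
  rw [show D - i = (D - (i + 1)) + 1 by omega, hv.down_step (by omega) (by omega), add_assoc]

/-- A correct pair of blocks brings the verifier to the end of the cycle. -/
lemma pair_eq (hv : IsValue θ w σ a r v) {t D : ℕ} (hD : D ≤ w.length)
    (h1 : IsBlock σ t (64 * D)) (h2 : IsBlock σ (t + 64 * D) D) :
    v (.communicating (.up 0)) 0 t = v (.reading (.ret (.up 0))) 0 (t + 64 * D + D) := by
  obtain ⟨E, hE, hE1, hE2⟩ := h1
  obtain ⟨F, rfl, hF1, hF2⟩ := h2
  rw [hv.up_run t E (by omega) hE1, (ZMod.natCast_eq_sixtyThree_iff E).2 (by omega),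
    hv.up_turn (by omega) hE2, show E / 64 + 1 = F + 1 by omega,
    show t + E + 1 = t + 64 * (F + 1) by omega]
  have h3 := scan_eq (hv.down_scan hD (t + 64 * (F + 1))) (fun i hi => hF1 i (by omega))
  simp only [add_zero, Nat.sub_zero] at h3
  rw [h3, show F + 1 - (F + 1 - 1) = 1 by omega, hv.down_last (by omega), Nat.add_sub_cancel,
    if_pos hF2]
  rfl

/-- If the check of a pair of blocks may accept, then the first block has length one, or it is
64 times as long as the second one. -/
lemma pair_sound (hv : IsValue θ w σ a 0 v) {t : ℕ}
    (h0 : 0 < v (.communicating (.up 0)) 0 t) :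
    (σ t).chain = true ∨ ∃ D, IsBlock σ t (64 * D) ∧ IsBlock σ (t + 64 * D) D ∧
      0 < v (.communicating (.up 0)) 0 (t + 64 * D + D) := by
  -- A first block that is too long drives the head to the right end-marker, where it is rejected.
  by_cases hc : ∀ i < 64 * (w.length + 1), (σ (t + i)).chain = false
  · rw [hv.up_run t _ le_rfl hc, hv.overflow _ (by omega)] at h0
    exact absurd h0 (lt_irrefl _)
  · push Not at hc
    have hex : ∃ i, (σ (t + i)).chain = true := by
      obtain ⟨i, -, hi⟩ := hc
      exact ⟨i, by simpa using hi⟩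
    classical
    set E := Nat.find hex with hE
    have hE2 : (σ (t + E)).chain = true := Nat.find_spec hex
    have hE1 : ∀ i < E, (σ (t + i)).chain = false := fun i hi => by
      simpa using Nat.find_min hex hi
    have hEw : E < 64 * (w.length + 1) := by
      obtain ⟨i, hi, hi'⟩ := hc
      exact (Nat.find_min' hex (by simpa using hi')).trans_lt hi
    rcases Nat.eq_zero_or_pos E with hz | hz
    · left
      rwa [hz] at hE2
    · right
      have hrun := hv.up_run t E hEw.le hE1
      have h63 : E % 64 = 63 := by
        by_contra hne
        rw [hrun, hv.up_fail (by rwa [Ne, ZMod.natCast_eq_sixtyThree_iff]) _ hE2] at h0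
        · exact lt_irrefl _ h0
        · by_contra hcon
          push Not at hcon
          have := (ZMod.natCast_eq_zero_iff E 64).1 hcon.2
          omega
      obtain ⟨F, hF⟩ : ∃ F, E + 1 = 64 * (F + 1) := ⟨E / 64, by omega⟩
      have hturn := hrun
      rw [(ZMod.natCast_eq_sixtyThree_iff E).2 h63, hv.up_turn (by omega) hE2,
        show E / 64 + 1 = F + 1 by omega, show t + E + 1 = t + 64 * (F + 1) by omega] at hturn
      have hFw : F + 1 ≤ w.length := by
        by_contra hlt
        rw [hturn, hv.overflow _ (by omega)] at h0
        exact lt_irrefl _ h0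
      have hb1 : IsBlock σ t (64 * (F + 1)) := ⟨E, hF.symm, hE1, hE2⟩
      have hscan := hv.down_scan hFw (t + 64 * (F + 1))
      have hun := scan_unmarked (g := fun i => v (.communicating .down) (F + 1 - i)
        (t + 64 * (F + 1) + i)) hscan (by simpa [← hturn] using h0)
      have h3 := scan_eq hscan hun
      simp only [add_zero, Nat.sub_zero] at h3
      have hb2 : IsBlock σ (t + 64 * (F + 1)) (F + 1) := by
        refine ⟨F, rfl, hun, ?_⟩
        by_contra hne
        rw [hturn, h3, show F + 1 - (F + 1 - 1) = 1 by omega, hv.down_last (by omega),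
          Nat.add_sub_cancel, if_neg hne] at h0
        exact lt_irrefl _ h0
      refine ⟨F + 1, hb1, hb2, ?_⟩
      rw [hv.pair_eq hFw hb1 hb2, hv.cycle_zero] at h0
      exact pos_of_mul_pos_right h0 (by linarith [lapse_lt_one w.length])

/-- If the two checks of adjacent pairs may both accept, then the block is a power of 64. -/
lemma chain_sound (hv : IsValue θ w σ a 0 v) (D t : ℕ) (hD : IsBlock σ t D)
    (h1 : 0 < v (.communicating (.up 0)) 0 t)
    (h2 : 0 < v (.communicating (.up 0)) 0 (t + D)) : ∃ j, D = 64 ^ j := by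
  induction D using Nat.strong_induction_on generalizing t with
  | _ D ih =>
    rcases hv.pair_sound h1 with hc | ⟨D', hb1, hb2, h3⟩
    · exact ⟨0, hD.unique ⟨0, rfl, by simp, hc⟩⟩
    · obtain rfl := hD.unique hb1
      have hpos : 0 < D' := by
        obtain ⟨E, rfl, -⟩ := hb2
        omega
      -- Having passed a pair, the first check overtakes the second by one block, so the two
      -- exchange their roles.
      obtain ⟨j, rfl⟩ := ih D' (by omega) (t + 64 * D') hb2 h2 h3
      exact ⟨j + 1, by ring⟩

/-- The value of a check that starts with the block of length `64 ^ j` of a correct chain. -/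
lemma chain_complete (hv : IsValue θ w σ 0 1 v) (S : ℕ → ℕ) (k : ℕ) (hk : 64 ^ k ≤ w.length)
    (hS : ∀ j < k, S j = S (j + 1) + 64 ^ (j + 1))
    (hb : ∀ j ≤ k, IsBlock σ (S j) (64 ^ j)) (hend : (σ (S 0 + 1)).chain = true) :
    ∀ j ≤ k, v (.communicating (.up 0)) 0 (S j) ≤ j * lapse w.length := by
  have hl := lapse_pos w.length
  intro j
  induction j using Nat.strong_induction_on with
  | _ j ih =>
    intro hj
    rcases j with _ | j
    · obtain ⟨E, hE, -, h2⟩ := hb 0 (by omega)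
      obtain rfl : E = 0 := by simpa using hE
      rw [add_zero] at h2
      simp [hv.up_one h2]
    · have h1 := hb (j + 1) hj
      have h2 := hb j (by omega)
      rw [hS j (by omega), pow_succ'] at h2
      rw [pow_succ'] at h1
      rw [hv.pair_eq ((Nat.pow_le_pow_right (by norm_num) (by omega)).trans hk) h1 h2]
      refine (hv.cycle_le le_rfl _ _ _).trans ?_
      have h3 : v (.communicating (.up 0)) (entryPos (.up 0))
          (S (j + 1) + 64 * 64 ^ j + 64 ^ j) ≤ j * lapse w.length := by
        rw [← pow_succ', ← hS j (by omega)]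
        change v _ 0 _ ≤ _
        -- After the pair of lengths 64 and 1 the check resumes behind the chain, where the
        -- additional mark `hend` makes it accept. Otherwise it resumes two blocks further on.
        rcases j with _ | j
        · simp [hv.up_one hend]
        · rw [← hS j (by omega)]
          refine (ih j (by omega) (by omega)).trans ?_
          push_cast
          nlinarith
      push_cast
      linarith

end PowerVerifier.IsValue

/-! ### The counting mode and the encoding of the set in the bias -/

namespace PowerVerifier

namespace IsValue

variable {θ : unitInterval} {w : List Unit} {σ : ℕ → Sym} {a r : ℝ} {v : St → ℕ → ℕ → ℝ}

lemma decision_eq (hv : IsValue θ w σ a r v) (s : ZMod 32) (h t : ℕ) :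
    v (decision s) h t = v (decision s) 0 0 := by
  unfold decision
  split_ifs <;> simp [hv.accept, hv.reject]

lemma cnt_step (hv : IsValue θ w σ a r v) (s : ZMod 32) {h : ℕ} (hw : h ≤ w.length) (t : ℕ) :
    v (.communicating (.cnt s)) h t =
      θ * v (.reading (.check (.cnt s) (σ t))) (h + 1) (t + 1) +
      (1 - θ) * v (.reading (.check (.cnt s) (σ t))) h (t + 1) := by
  have ho : ∀ b, outcome (.act (.cnt s) (σ t)) (tapeSymbolAt w h) b =
      (.reading (.check (.cnt s) (σ t)), if b then .right else .stay) := by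
    intro b
    have hne := tapeSymbolAt_ne_rightEnd hw
    rcases hx : tapeSymbolAt w h with _ | _ | _ <;> first | exact absurd hx hne | rfl
  rw [hv.communicating, hv.reading, ho, ho]
  simp only [if_true, Bool.false_eq_true, if_false, moveHead_right hw]
  rfl

lemma cnt_check (hv : IsValue θ w σ a r v) (s : ZMod 32) (u : Sym) {h : ℕ} (hw : h ≤ w.length)
    (t : ℕ) : v (.reading (.check (.cnt s) u)) h t =
      if u.both then v (decision s) 0 0 else v (.communicating (.cnt s)) h t := by
  rw [hv.check_eq]
  have hne := tapeSymbolAt_ne_rightEnd hw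
  rcases hx : tapeSymbolAt w h with _ | _ | _ <;>
    first | exact absurd hx hne | (simp only [verdict]; split_ifs <;> simp [hv.decision_eq _ h t])

lemma cnt_wrap (hv : IsValue θ w σ a r v) (s : ZMod 32) (u : Sym) (t : ℕ) :
    v (.reading (.check (.cnt s) u)) (w.length + 1) t =
      if u.both then v (decision (s + 1)) 0 0 else v (.reading (.ret (.cnt (s + 1)))) 0 t := by
  rw [hv.check_eq, tapeSymbolAt_rightEnd (by omega)]
  simp only [verdict]
  split_ifs <;> simp [hv.decision_eq _ (w.length + 1) t, hv.ret_eq _ (w.length + 1)]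

/-- Chebyshev's inequality for the counting mode: the value is bounded by the second moment of
the distance of the number of heads from `μ` and by the probability of a lapse. -/
lemma cnt_le (hv : IsValue θ w σ a r v) (hr : r ≤ 1) {T : ℕ} (hT : (σ T).both = true)
    (hT' : ∀ i < T, (σ i).both = false) {μ W : ℝ} (hW : 0 < W)
    (hdec : ∀ q h : ℕ, h ≤ w.length → |((q * (w.length + 1) + h : ℕ) : ℝ) - μ| < W →
      v (decision q) 0 0 = 0) :
    ∀ m t q h : ℕ, t + m = T → h ≤ w.length →
      v (.communicating (.cnt q)) h t ≤
        ((q * (w.length + 1) + h + (m + 1) * θ - μ) ^ 2 + (m + 1) * (θ * (1 - θ))) / W ^ 2 +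
        lapse w.length * ((h + m + 1) / (w.length + 1)) := by
  have hl := lapse_pos w.length
  have hM : (0 : ℝ) < w.length + 1 := by positivity
  have hθ0 : (0 : ℝ) ≤ θ := θ.2.1
  have hθ1 : (θ : ℝ) ≤ 1 := θ.2.2
  have hdec' : ∀ q h : ℕ, h ≤ w.length →
      v (decision q) 0 0 ≤ (q * (w.length + 1) + h - μ) ^ 2 / W ^ 2 := by
    intro q h hh
    by_cases hlt : |((q * (w.length + 1) + h : ℕ) : ℝ) - μ| < W
    · rw [hdec q h hh hlt]; positivity
    · refine (hv.le_one _ _ _).trans ?_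
      rw [one_le_div (by positivity)]
      have := not_lt.1 hlt
      push_cast at this
      rw [← sq_abs (_ - μ)]
      gcongr
  -- the bound after a toss, with `m` tosses to come
  have hcheck : ∀ m t q h : ℕ, t + m = T → h ≤ w.length + 1 →
      (∀ q h : ℕ, h ≤ w.length → (σ t).both = false → v (.communicating (.cnt q)) h (t + 1) ≤
        ((q * (w.length + 1) + h + m * θ - μ) ^ 2 + m * (θ * (1 - θ))) / W ^ 2 +
        lapse w.length * ((h + m) / (w.length + 1))) →
      v (.reading (.check (.cnt q) (σ t))) h (t + 1) ≤
        ((q * (w.length + 1) + h + m * θ - μ) ^ 2 + m * (θ * (1 - θ))) / W ^ 2 +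
        lapse w.length * ((h + m) / (w.length + 1)) := by
    intro m t q h hm hh hnext
    rcases Nat.lt_or_ge t T with hlt | hge
    · have hb := hT' t hlt
      rcases Nat.lt_or_ge w.length h with h1 | h1
      · obtain rfl : h = w.length + 1 := by omega
        rw [hv.cnt_wrap, if_neg (by simp [hb])]
        have h2 := hnext (q + 1) 0 (Nat.zero_le _) hb
        have h3 := hv.cycle_le hr (.cnt ((q : ZMod 32) + 1)) 0 (t + 1)
        change _ ≤ v (.communicating (.cnt ((q : ZMod 32) + 1))) 0 (t + 1) + _ at h3
        push_cast at h2 ⊢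
        -- A completed pass uses up one unit of `(h + m) / (n + 1)`, which pays for the possible
        -- lapse before the next cycle.
        have e1 : ((w.length : ℝ) + 1 + m) / (w.length + 1) = 1 + (0 + m) / (w.length + 1) := by
          field_simp
          ring
        rw [e1]
        have e2 : (q : ℝ) * (w.length + 1) + (w.length + 1) + m * θ - μ =
          (q + 1) * (w.length + 1) + 0 + m * θ - μ := by ring
        rw [e2]
        linarith
      · rw [hv.cnt_check _ _ h1, if_neg (by simp [hb])]
        exact hnext q h h1 hb
    · obtain rfl : t = T := by omega
      obtain rfl : m = 0 := by omega
      have hnn : 0 ≤ lapse w.length * ((h + (0 : ℕ)) / (w.length + 1)) := by positivity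
      refine le_trans ?_ (le_add_of_nonneg_right hnn)
      push_cast
      simp only [zero_mul, add_zero]
      rcases Nat.lt_or_ge w.length h with h1 | h1
      · obtain rfl : h = w.length + 1 := by omega
        rw [hv.cnt_wrap, if_pos hT]
        have h2 := hdec' (q + 1) 0 (Nat.zero_le _)
        push_cast at h2 ⊢
        have e2 : (q : ℝ) * (w.length + 1) + (w.length + 1) - μ =
          (q + 1) * (w.length + 1) + 0 - μ := by ring
        rw [e2]
        exact h2
      · rw [hv.cnt_check _ _ h1, if_pos hT]
        exact hdec' q h h1
  have hstep : ∀ m t q h : ℕ, t + m = T → h ≤ w.length →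
      (∀ q h : ℕ, h ≤ w.length → (σ t).both = false → v (.communicating (.cnt q)) h (t + 1) ≤
        ((q * (w.length + 1) + h + m * θ - μ) ^ 2 + m * (θ * (1 - θ))) / W ^ 2 +
        lapse w.length * ((h + m) / (w.length + 1))) →
      v (.communicating (.cnt q)) h t ≤
        ((q * (w.length + 1) + h + (m + 1) * θ - μ) ^ 2 + (m + 1) * (θ * (1 - θ))) / W ^ 2 +
        lapse w.length * ((h + m + 1) / (w.length + 1)) := by
    intro m t q h hm hh hnext
    rw [hv.cnt_step _ hh]
    have h1 := mul_le_mul_of_nonneg_left (hcheck m t q (h + 1) hm (by omega) hnext) hθ0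
    have h2 := mul_le_mul_of_nonneg_left (hcheck m t q h hm (by omega) hnext)
      (sub_nonneg.2 hθ1)
    refine (add_le_add h1 h2).trans ?_
    push_cast
    have h3 : (1 - θ : ℝ) * (lapse w.length * ((h + m) / (w.length + 1))) ≤
        (1 - θ) * (lapse w.length * ((h + m + 1) / (w.length + 1))) := by
      refine mul_le_mul_of_nonneg_left (mul_le_mul_of_nonneg_left ?_ hl.le) (sub_nonneg.2 hθ1)
      exact div_le_div_of_nonneg_right (by linarith) hM.le
    -- Averaging over one toss replaces the position by its mean and adds the variance `θ (1 - θ)`.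
    have e : (θ : ℝ) * (((q * (w.length + 1) + (h + 1) + m * θ - μ) ^ 2 + m * (θ * (1 - θ))) / W ^ 2)
        + (1 - θ) * (((q * (w.length + 1) + h + m * θ - μ) ^ 2 + m * (θ * (1 - θ))) / W ^ 2) =
        ((q * (w.length + 1) + h + (m + 1) * θ - μ) ^ 2 + (m + 1) * (θ * (1 - θ))) / W ^ 2 := by
      ring
    have e1 : (h : ℝ) + 1 + m = h + m + 1 := by ring
    rw [e1]
    linarith
  intro m
  induction m with
  | zero =>
    intro t q h hm hh
    refine hstep 0 t q h hm hh ?_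
    intro q h hh hb
    obtain rfl : t = T := by omega
    rw [hT] at hb
    cases hb
  | succ m ih =>
    intro t q h hm hh
    refine hstep (m + 1) t q h hm hh ?_
    intro q h hh hb
    have := ih (t + 1) q h (by omega) hh
    push_cast
    rw [← add_assoc]
    exact this

end IsValue

/-- The bias of the counting coin that encodes the set `I`. -/
lemma exists_bias (I : Set ℕ+) [DecidablePred (· ∈ I)] : ∃ θ : unitInterval, 1 / 8 ≤ (θ : ℝ) ∧
    ∀ k : ℕ+, ∃ E : ℕ, ∃ ρ : ℝ, 1 / 4 ≤ ρ ∧ ρ ≤ 3 / 4 ∧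
      64 ^ (k : ℕ) * (θ : ℝ) / 16 = 2 * E + (if k ∈ I then 1 else 0) + ρ := by
  set χ : ℕ → ℝ := fun j => if j.succPNat ∈ I then 1 else 0 with hχ
  have hχ0 : ∀ j, 0 ≤ χ j := fun j => by simp only [hχ]; split_ifs <;> norm_num
  have hχ1 : ∀ j, χ j ≤ 1 := fun j => by simp only [hχ]; split_ifs <;> norm_num
  have hgeo : HasSum (fun j : ℕ => (1 / 64 : ℝ) ^ j) (64 / 63) := by
    have := hasSum_geometric_of_lt_one (r := (1 / 64 : ℝ)) (by norm_num) (by norm_num)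
    convert this using 1
    norm_num
  have hle : ∀ k j, χ (k + j) * (1 / 64 : ℝ) ^ j ≤ (1 / 64 : ℝ) ^ j := fun k j =>
    mul_le_of_le_one_left (by positivity) (hχ1 _)
  have hnn : ∀ k j, 0 ≤ χ (k + j) * (1 / 64 : ℝ) ^ j := fun k j =>
    mul_nonneg (hχ0 _) (by positivity)
  have hsum : ∀ k, Summable fun j => χ (k + j) * (1 / 64 : ℝ) ^ j := fun k =>
    Summable.of_nonneg_of_le (hnn k) (hle k) hgeo.summable
  -- `s k` is the base-64 expansion with the digits of `I` from index `k` on.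
  set s : ℕ → ℝ := fun k => ∑' j, χ (k + j) * (1 / 64 : ℝ) ^ j with hs
  have hs0 : ∀ k, 0 ≤ s k := fun k => tsum_nonneg (hnn k)
  have hs1 : ∀ k, s k ≤ 64 / 63 := fun k => by
    rw [← hgeo.tsum_eq]
    exact (hsum k).tsum_le_tsum (hle k) hgeo.summable
  have hrec : ∀ k, s k = χ k + s (k + 1) / 64 := by
    intro k
    simp only [hs]
    rw [(hsum k).tsum_eq_zero_add, ← tsum_div_const]
    simp only [add_zero, pow_zero, mul_one]
    congr 1
    refine tsum_congr fun j => ?_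
    rw [show k + (j + 1) = k + 1 + j by ring, pow_succ]
    ring
  -- As `64 · 32/63 = 32 + 32/63`, multiplication by 64 preserves the offset, shifts the digits and
  -- splits off an even integer.
  have hpow : ∀ k, ∃ E : ℕ, 64 ^ k * (32 / 63 + s 0) = 2 * (E : ℝ) + (32 / 63 + s k) := by
    intro k
    induction k with
    | zero => exact ⟨0, by simp⟩
    | succ k ih =>
      obtain ⟨E, hE⟩ := ih
      obtain ⟨e, he⟩ : ∃ e : ℕ, χ k = e := by
        simp only [hχ]
        split_ifs
        · exact ⟨1, by simp⟩
        · exact ⟨0, by simp⟩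
      refine ⟨64 * E + 16 + 32 * e, ?_⟩
      have := hrec k
      rw [he] at this
      rw [pow_succ']
      push_cast
      linarith
  -- The divisions by 4 and by 16 together cancel one factor 64. The offset gives `θ ≥ 8/63 > 1/8`
  -- and keeps `ρ` close to 1/2.
  refine ⟨⟨(32 / 63 + s 0) / 4, by linarith [hs0 0], by linarith [hs1 0]⟩, ?_, ?_⟩
  · change 1 / 8 ≤ (32 / 63 + s 0) / 4
    linarith [hs0 0]
  · intro k
    obtain ⟨j, rfl⟩ : ∃ j : ℕ, k = j.succPNat := ⟨k.natPred, by simp⟩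
    obtain ⟨E, hE⟩ := hpow j
    refine ⟨E, 32 / 63 + s (j + 1) / 64, by linarith [hs0 (j + 1)], by linarith [hs1 (j + 1)], ?_⟩
    change 64 ^ (j + 1) * ((32 / 63 + s 0) / 4) / 16 = 2 * (E : ℝ) + χ j + _
    have := hrec j
    rw [pow_succ]
    linarith

/-- The number of completed passes determines membership if the number of heads is near its mean. -/
lemma pass_parity {n k q h E : ℕ} {x : ℕ} (hx : x ≤ 1) {θ ρ : ℝ} (hn : n = 64 ^ k) (hρ : 1 / 4 ≤ ρ)
    (hρ' : ρ ≤ 3 / 4) (hE : 64 ^ k * θ / 16 = 2 * E + x + ρ) (hh : h ≤ n)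
    (hC : |((q * (n + 1) + h : ℕ) : ℝ) - n * (n + 1) * θ| < 4 * (n + 1)) :
    16 ≤ (q : ZMod 32).val ↔ x = 1 := by
  have hM : (0 : ℝ) < n + 1 := by positivity
  have hh' : (h : ℝ) ≤ n := by exact_mod_cast hh
  have h0 : (0 : ℝ) ≤ h := h.cast_nonneg
  have hnr : (n : ℝ) = 64 ^ k := by rw [hn]; push_cast; rfl
  have hθ : (n : ℝ) * θ = 16 * (2 * E + x + ρ) := by rw [hnr]; linarith
  have hmean : (n : ℝ) * (n + 1) * θ = (n + 1) * (16 * (2 * E + x + ρ)) := by rw [← hθ]; ring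
  rw [hmean, abs_lt] at hC
  push_cast at hC
  -- Since `4 ≤ 16 ρ ≤ 12`, a deviation of less than four passes leaves `q` among the 16 values from
  -- `32 E + 16 x` on.
  have h1 : (32 * E + 16 * x : ℝ) < q + 1 := by
    by_contra hcon
    have := mul_le_mul_of_nonneg_right (not_lt.1 hcon) hM.le
    nlinarith [hC.1]
  have h2 : (q : ℝ) < 32 * E + 16 * x + 16 := by
    by_contra hcon
    have := mul_le_mul_of_nonneg_right (not_lt.1 hcon) hM.le
    nlinarith [hC.2]
  have h1' : 32 * E + 16 * x < q + 1 := by exact_mod_cast h1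
  have h2' : q < 32 * E + 16 * x + 16 := by exact_mod_cast h2
  rw [ZMod.val_natCast]
  omega

end PowerVerifier

/-! ### The expected running time -/

lemma moveHead_le {A : Type} (w : List A) {h : ℕ} (hh : h ≤ w.length + 1) (d : HeadMove) :
    moveHead w h d ≤ w.length + 1 := by
  cases d <;> simp only [moveHead] <;> omega

namespace PowerVerifier

/-- A bound on the expected time until the end of the cycle. -/
noncomputable def cycleTime (n : ℕ) : Mode → ℕ → ℝ
  -- At most `64 (n + 1 - h) - j` symbols can be read before the right end, at two steps each. The
  -- rest pays for the way back and keeps the bound positive at the right end, where the bracket may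
  -- be as low as `-63`.
  | .up j, h => 6 * (n + 1) + 400 + 4 * (64 * (n + 1 - h) - j.val)
  | .down, h => n + 1 + 10 + 4 * h
  -- A symbol costs three steps, and in the counting mode the head advances with probability at
  -- least 1/8; hence `24 = 3 · 8`.
  | _, h => n + 1 + 10 + 24 * (n + 1 - h)

/-- A bound on the expected remaining time. -/
noncomputable def timeBound (n : ℕ) : St → ℕ → ℝ
  -- A cycle is bounded by `800 (n + 1)` steps and a lapse has probability `1 / (64 (n + 1))`. In
  -- `51201 = 64 · 800 + 1` the summand 1 pays for the random walk.
  | .communicating m, h => 51201 * (n + 1) ^ 2 + cycleTime n m h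
  | .accept, _ => 0
  | .reject, _ => 0
  | .reading (.look i), h => 51201 * (n + 1) ^ 2 + h + 20 - 3 * (i : ℕ)
  | .reading (.pick i), h => 51201 * (n + 1) ^ 2 + h + 8 - (i : ℕ)
  | .reading (.ret _), h => 51201 * (n + 1) ^ 2 + h + 1
  -- `h (n + 1 - h)` is the expected exit time of the walk, and `1 - h / (n + 1)` the probability of
  -- leaving it on the left.
  | .reading (.walk _), h => h * (n + 1 - h) +
      (1 - h / (n + 1)) * (51201 * (n + 1) ^ 2 + 800 * (n + 1)) + 1
  | .reading (.act m _), h => 51201 * (n + 1) ^ 2 + cycleTime n m h - 1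
  | .reading (.check m _), h => 51201 * (n + 1) ^ 2 + cycleTime n m h + 1

lemma val_le (j : ZMod 64) : (j.val : ℝ) ≤ 63 := by
  exact_mod_cast Nat.le_of_lt_succ (ZMod.val_lt j)

lemma val_add_one : ∀ {j : ZMod 64}, j ≠ 63 → (j + 1).val = j.val + 1 := by decide

lemma fin_val_add_one : ∀ {i : Fin 5}, i ≠ 4 → ((i + 1 : Fin 5) : ℕ) = i + 1 := by decide

/-- This reserve pays for the return to the left end-marker from any cell. -/
lemma le_cycleTime {n : ℕ} (m : Mode) {h : ℕ} (hh : h ≤ n + 1) : (n : ℝ) + 11 ≤ cycleTime n m h := by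
  have h1 : (h : ℝ) ≤ n + 1 := by exact_mod_cast hh
  have h0 : (0 : ℝ) ≤ h := h.cast_nonneg
  rcases m with _ | _ | j | _ | _ <;> simp only [cycleTime] <;> try linarith
  linarith [val_le j]

lemma cycleTime_entryPos_le (n : ℕ) (m : Mode) :
    cycleTime n m (entryPos m) ≤ 800 * (n + 1) := by
  have h0 : (0 : ℝ) ≤ n := n.cast_nonneg
  rcases m with (_ | _) | _ | j | _ | _ <;> simp only [cycleTime, entryPos] <;> push_cast <;>
    linarith

lemma timeBound_nonneg {n : ℕ} (q : St) {h : ℕ} (hh : h ≤ n + 1) : 0 ≤ timeBound n q h := by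
  have h1 : (h : ℝ) ≤ n + 1 := by exact_mod_cast hh
  have h0 : (0 : ℝ) ≤ h := h.cast_nonneg
  have hn : (0 : ℝ) ≤ n := n.cast_nonneg
  have hτ : (0 : ℝ) ≤ 51201 * (n + 1) ^ 2 := by positivity
  rcases q with (i | i | m | m | ⟨m, u⟩ | ⟨m, u⟩) | m | _ | _ <;> simp only [timeBound] <;>
    first | exact le_rfl | linarith [le_cycleTime m hh] | skip
  · have : ((i : ℕ) : ℝ) ≤ 2 := by exact_mod_cast Nat.le_of_lt_succ i.2
    linarith
  · have : ((i : ℕ) : ℝ) ≤ 4 := by exact_mod_cast Nat.le_of_lt_succ i.2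
    linarith
  · have h2 : 0 ≤ (h : ℝ) * (n + 1 - h) := mul_nonneg h0 (by linarith)
    have h3 : 0 ≤ 1 - (h : ℝ) / (n + 1) := sub_nonneg.2 ((div_le_one (by positivity)).2 h1)
    positivity

section step

variable {n : ℕ}

lemma timeBound_decision (s : ZMod 32) (h : ℕ) : timeBound n (decision s) h = 0 := by
  unfold decision
  split_ifs <;> rfl

/-- The bound decreases when a certificate symbol has been checked. -/
lemma timeBound_verdict {w : List Unit} (u : Sym) (m : Mode) {h : ℕ} (hh : h ≤ w.length + 1) :
    1 + timeBound w.length (verdict u m (tapeSymbolAt w h)) h ≤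
      timeBound w.length (.reading (.check m u)) h := by
  have h1 : (h : ℝ) ≤ w.length + 1 := by exact_mod_cast hh
  have h0 : (0 : ℝ) ≤ h := h.cast_nonneg
  have hn : (0 : ℝ) ≤ w.length := Nat.cast_nonneg _
  have hτ : (0 : ℝ) ≤ 51201 * (w.length + 1) ^ 2 := by positivity
  have hc := le_cycleTime m hh
  rcases m with d | _ | j | _ | s <;> rcases hx : tapeSymbolAt w h with _ | _ | _ <;>
    simp only [verdict] <;> (try split_ifs) <;> (try rw [timeBound_decision]) <;>
    simp only [timeBound, cycleTime] at * <;> linarith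

/-- The bound decreases when the verifier reacts to a certificate symbol. -/
lemma timeBound_react {w : List Unit} (θ : unitInterval) (hθ : 1 / 8 ≤ (θ : ℝ)) (u : Sym)
    (m : Mode) {h : ℕ} (hh : h ≤ w.length + 1) :
    1 + (θ * timeBound w.length (react m u (tapeSymbolAt w h) true).1
        (moveHead w h (react m u (tapeSymbolAt w h) true).2) +
      (1 - θ) * timeBound w.length (react m u (tapeSymbolAt w h) false).1
        (moveHead w h (react m u (tapeSymbolAt w h) false).2)) ≤
      timeBound w.length (.reading (.act m u)) h := by
  have h1 : (h : ℝ) ≤ w.length + 1 := by exact_mod_cast hh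
  have h0 : (0 : ℝ) ≤ h := h.cast_nonneg
  have hn : (0 : ℝ) ≤ w.length := Nat.cast_nonneg _
  have hτ : (0 : ℝ) ≤ 51201 * (w.length + 1) ^ 2 := by positivity
  have hc := le_cycleTime m hh
  have hdet : ∀ o : St × HeadMove, (∀ b, react m u (tapeSymbolAt w h) b = o) →
      1 + timeBound w.length o.1 (moveHead w h o.2) ≤
        timeBound w.length (.reading (.act m u)) h →
      1 + (θ * timeBound w.length (react m u (tapeSymbolAt w h) true).1
        (moveHead w h (react m u (tapeSymbolAt w h) true).2) +
      (1 - θ) * timeBound w.length (react m u (tapeSymbolAt w h) false).1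
        (moveHead w h (react m u (tapeSymbolAt w h) false).2)) ≤
      timeBound w.length (.reading (.act m u)) h := by
    intro o ho hle
    rw [ho, ho]
    linarith
  rcases Nat.lt_or_ge w.length h with hr | hr
  · refine hdet (.reject, .stay) (fun b => by rw [tapeSymbolAt_rightEnd hr]; rfl) ?_
    simp only [timeBound]
    linarith
  have hne := tapeSymbolAt_ne_rightEnd hr
  have hr' : (h : ℝ) ≤ w.length := by exact_mod_cast hr
  rcases m with d | _ | j | _ | s
  · refine hdet (.reading (.check (.lap d) u), .right) (fun b => ?_) ?_
    · rcases hx : tapeSymbolAt w h with _ | _ | _ <;> first | exact absurd hx hne | rfl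
    · simp only [timeBound, cycleTime, moveHead_right hr]
      push_cast
      linarith
  · refine hdet (.reading (.check .whole u), .right) (fun b => ?_) ?_
    · rcases hx : tapeSymbolAt w h with _ | _ | _ <;> first | exact absurd hx hne | rfl
    · simp only [timeBound, cycleTime, moveHead_right hr]
      push_cast
      linarith
  · have hj := val_le j
    by_cases hu : u.chain = true
    · by_cases h63 : j = 63
      · refine hdet (.communicating .down, .right) (fun b => ?_) ?_
        · rcases hx : tapeSymbolAt w h with _ | _ | _ <;>
            first | exact absurd hx hne | simp [react, hu, h63]
        · simp only [timeBound, cycleTime, moveHead_right hr]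
          push_cast
          linarith
      · have hhalt : ∀ b, (react (.up j) u (tapeSymbolAt w h) b) = (.accept, .stay) ∨
            (react (.up j) u (tapeSymbolAt w h) b) = (.reject, .stay) := by
          intro b
          rcases hx : tapeSymbolAt w h with _ | _ | _
          · have h0 : (0 : ZMod 64) ≠ 63 := by decide
            by_cases h00 : j = 0 <;> simp [react, hu, h63, h00, h0]
          · simp [react, hu, h63]
          · exact absurd hx hne
        have hz : ∀ b, timeBound w.length (react (.up j) u (tapeSymbolAt w h) b).1
            (moveHead w h (react (.up j) u (tapeSymbolAt w h) b).2) = 0 := by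
          intro b
          rcases hhalt b with hb | hb <;> rw [hb] <;> rfl
        rw [hz, hz]
        simp only [timeBound]
        linarith
    · refine hdet (.communicating (.up (j + 1)), if j = 63 then .right else .stay)
        (fun b => ?_) ?_
      · rcases hx : tapeSymbolAt w h with _ | _ | _ <;>
          first | exact absurd hx hne | simp [react, hu]
      · by_cases h63 : j = 63
        · subst h63
          have e1 : ((63 : ZMod 64) + 1).val = 0 := by decide
          have e2 : (63 : ZMod 64).val = 63 := by decide
          simp only [timeBound, cycleTime, if_true, moveHead_right hr, e1, e2]
          push_cast
          linarith
        · have e1 : (j + 1).val = j.val + 1 := val_add_one h63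
          simp only [timeBound, cycleTime, if_neg h63, moveHead, e1]
          push_cast
          linarith
  · rcases Nat.eq_zero_or_pos h with rfl | hpos
    · refine hdet (.reject, .stay) (fun b => rfl) ?_
      simp only [timeBound]
      linarith
    · refine hdet (.reading (.check .down u), .left) (fun b => ?_) ?_
      · rw [tapeSymbolAt_letter hpos.ne' hr]; rfl
      · simp only [timeBound, cycleTime, moveHead]
        rw [Nat.cast_sub hpos]
        push_cast
        linarith
  · have ho : ∀ b, react (.cnt s) u (tapeSymbolAt w h) b =
        (.reading (.check (.cnt s) u), if b then .right else .stay) := by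
      intro b
      rcases hx : tapeSymbolAt w h with _ | _ | _ <;> first | exact absurd hx hne | rfl
    rw [ho, ho]
    simp only [timeBound, cycleTime, if_true, Bool.false_eq_true, if_false, moveHead_right hr]
    simp only [moveHead]
    push_cast
    linarith

/-- The bound decreases on average by at least one in every reading step. -/
lemma timeBound_step (w : List Unit) (θ : unitInterval) (hθ : 1 / 8 ≤ (θ : ℝ)) (s : Control)
    {h : ℕ} (hh : h ≤ w.length + 1) :
    1 + (bias θ s * timeBound w.length (outcome s (tapeSymbolAt w h) true).1
        (moveHead w h (outcome s (tapeSymbolAt w h) true).2) +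
      (1 - bias θ s) * timeBound w.length (outcome s (tapeSymbolAt w h) false).1
        (moveHead w h (outcome s (tapeSymbolAt w h) false).2)) ≤
      timeBound w.length (.reading s) h := by
  have h1 : (h : ℝ) ≤ w.length + 1 := by exact_mod_cast hh
  have h0 : (0 : ℝ) ≤ h := h.cast_nonneg
  have hn : (0 : ℝ) ≤ w.length := Nat.cast_nonneg _
  have hτ : (0 : ℝ) ≤ 51201 * (w.length + 1) ^ 2 := by positivity
  have hM : (0 : ℝ) < w.length + 1 := by positivity
  have hdet : ∀ o : St × HeadMove, (∀ b, outcome s (tapeSymbolAt w h) b = o) →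
      1 + timeBound w.length o.1 (moveHead w h o.2) ≤ timeBound w.length (.reading s) h →
      1 + (bias θ s * timeBound w.length (outcome s (tapeSymbolAt w h) true).1
        (moveHead w h (outcome s (tapeSymbolAt w h) true).2) +
      (1 - bias θ s) * timeBound w.length (outcome s (tapeSymbolAt w h) false).1
        (moveHead w h (outcome s (tapeSymbolAt w h) false).2)) ≤
      timeBound w.length (.reading s) h := by
    intro o ho hle
    rw [ho, ho]
    linarith
  have hright : ((moveHead w h .right : ℕ) : ℝ) ≤ h + 1 := by
    exact_mod_cast (min_le_left _ _ : min (h + 1) (w.length + 1) ≤ h + 1)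
  rcases s with i | i | m | m | ⟨m, u⟩ | ⟨m, u⟩
  · have hi : ((i : ℕ) : ℝ) ≤ 2 := by exact_mod_cast Nat.le_of_lt_succ i.2
    have hrej : 1 + timeBound w.length .reject (moveHead w h .stay) ≤
        timeBound w.length (.reading (.look i)) h := by
      simp only [timeBound]
      linarith
    rcases hx : tapeSymbolAt w h with _ | _ | _ <;> fin_cases i <;> rw [hx] at hdet <;>
      first
      | exact hdet (.reject, .stay) (fun _ => rfl) hrej
      | refine hdet (.reading (.look 1), .right) (fun _ => rfl) ?_
        simp [timeBound]
        linarith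
      | refine hdet (.reading (.look 2), .right) (fun _ => rfl) ?_
        simp [timeBound]
        linarith
      | refine hdet (.reading (.pick 0), .stay) (fun _ => rfl) ?_
        simp [timeBound, moveHead]
        linarith
  · have hp0 := (bias θ (.pick i)).2.1
    have hp1 := (bias θ (.pick i)).2.2
    have hi : ((i : ℕ) : ℝ) ≤ 4 := by exact_mod_cast Nat.le_of_lt_succ i.2
    set p : ℝ := (bias θ (.pick i) : ℝ)
    have hA : timeBound w.length (.reading (.ret (startMode i))) h ≤
        timeBound w.length (.reading (.pick i)) h - 1 := by
      simp only [timeBound]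
      linarith
    have hB : timeBound w.length (if i = 4 then .reject else .reading (.pick (i + 1))) h ≤
        timeBound w.length (.reading (.pick i)) h - 1 := by
      by_cases h4 : i = 4
      · rw [if_pos h4]
        simp only [timeBound]
        linarith
      · have e : ((i + 1 : Fin 5) : ℕ) = i + 1 := fin_val_add_one h4
        rw [if_neg h4]
        simp only [timeBound, e]
        push_cast
        linarith
    have := mul_le_mul_of_nonneg_left hA hp0
    have := mul_le_mul_of_nonneg_left hB (sub_nonneg.2 hp1)
    change 1 + (p * timeBound w.length (.reading (.ret (startMode i))) h +
      (1 - p) * timeBound w.length (if i = 4 then .reject else .reading (.pick (i + 1))) h) ≤ _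
    linarith
  · rcases Nat.eq_zero_or_pos h with rfl | hpos
    · have hE := cycleTime_entryPos_le w.length m
      change 1 + (1 / 64 * timeBound w.length (.reading (.walk m)) (moveHead w 0 .right) +
        (1 - 1 / 64) * timeBound w.length (.communicating m) (moveHead w 0 (entryMove m))) ≤ _
      rw [moveHead_right (Nat.zero_le _), moveHead_entryMove]
      simp only [timeBound]
      push_cast
      have e : (1 - 1 / ((w.length : ℝ) + 1)) *
          (51201 * (w.length + 1) ^ 2 + 800 * (w.length + 1)) =
          51201 * (w.length + 1) ^ 2 + 800 * (w.length + 1) - (51201 * (w.length + 1) + 800) := by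
        field_simp
      rw [e]
      linarith
    · refine hdet (.reading (.ret m), .left) (fun b => ?_) ?_
      · rcases hx : tapeSymbolAt w h with _ | _ | _
        · exact absurd hx (tapeSymbolAt_ne_leftEnd hpos.ne')
        · rfl
        · rfl
      · simp only [timeBound, moveHead]
        rw [Nat.cast_sub hpos]
        push_cast
        linarith
  · rcases Nat.eq_zero_or_pos h with rfl | hpos
    · refine hdet (.communicating m, entryMove m) (fun _ => rfl) ?_
      rw [moveHead_entryMove]
      have := cycleTime_entryPos_le w.length m
      simp only [timeBound]
      push_cast
      rw [zero_div]
      linarith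
    rcases Nat.lt_or_ge w.length h with hr | hr
    · refine hdet (.reject, .stay) (fun b => by rw [tapeSymbolAt_rightEnd hr]; rfl) ?_
      obtain rfl : h = w.length + 1 := by omega
      simp only [timeBound]
      push_cast
      rw [div_self hM.ne']
      linarith
    · rw [tapeSymbolAt_letter hpos.ne' hr]
      simp only [outcome, if_true, Bool.false_eq_true, if_false, bias, moveHead_right hr]
      simp only [timeBound, moveHead]
      rw [Nat.cast_sub hpos]
      push_cast
      apply le_of_eq
      field_simp
      ring
  · exact timeBound_react θ hθ u m hh
  · exact hdet (verdict u m (tapeSymbolAt w h), .stay) (fun _ => rfl) (timeBound_verdict u m hh)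

end step

open TwoPFAVerifier in
lemma expectedTime_le (θ : unitInterval) (hθ : 1 / 8 ≤ (θ : ℝ)) (P : (verifier θ).Prover)
    (w : List Unit) : (verifier θ).expectedTime P w ≤
      ENNReal.ofReal (51201 * (w.length + 1) ^ 2 + 20) := by
  have h := (verifier θ).expectedTime_le P w
    -- The closed set: head on the tape and a history of equal messages.
    {c | ∃ q h t, h ≤ w.length + 1 ∧ c = conf θ q h t}
    (fun c => ENNReal.ofReal (timeBound w.length c.state c.head))
    ⟨.reading (.look 0), 0, 0, Nat.zero_le _, rfl⟩ ?_ ?_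
  · refine h.trans (le_of_eq ?_)
    change ENNReal.ofReal (timeBound w.length (.reading (.look 0)) 0) = _
    simp [timeBound]
  · rintro c ⟨q, h, t, hh, rfl⟩ f g hfg
    rcases q with s | m | _ | _
    · rw [next_reading, next_reading]
      exact add_le_add
        (mul_le_mul_right (hfg _ ⟨_, _, _, moveHead_le w hh _, rfl⟩) _)
        (mul_le_mul_right (hfg _ ⟨_, _, _, moveHead_le w hh _, rfl⟩) _)
    · rw [next_communicating, next_communicating]
      exact hfg _ ⟨_, _, _, hh, rfl⟩
    · rw [next_of_isHalting P w (Or.inl rfl), next_of_isHalting P w (Or.inl rfl)]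
      exact hfg _ ⟨_, _, _, hh, rfl⟩
    · rw [next_of_isHalting P w (Or.inr rfl), next_of_isHalting P w (Or.inr rfl)]
      exact hfg _ ⟨_, _, _, hh, rfl⟩
  · rintro c ⟨q, h, t, hh, rfl⟩ hnh
    rcases q with s | m | _ | _
    · rw [next_reading]
      have hp := (bias θ s).2
      have h1 := timeBound_nonneg (outcome s (tapeSymbolAt w h) true).1
        (moveHead_le w hh (outcome s (tapeSymbolAt w h) true).2)
      have h2 := timeBound_nonneg (outcome s (tapeSymbolAt w h) false).1
        (moveHead_le w hh (outcome s (tapeSymbolAt w h) false).2)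
      simp only [conf]
      rw [← ENNReal.ofReal_mul hp.1, ← ENNReal.ofReal_mul (sub_nonneg.2 hp.2),
        ← ENNReal.ofReal_add (mul_nonneg hp.1 h1) (mul_nonneg (sub_nonneg.2 hp.2) h2),
        ← ENNReal.ofReal_one, ← ENNReal.ofReal_add zero_le_one
          (add_nonneg (mul_nonneg hp.1 h1) (mul_nonneg (sub_nonneg.2 hp.2) h2))]
      exact ENNReal.ofReal_le_ofReal (timeBound_step w θ hθ s hh)
    · rw [next_communicating]
      have h1 := timeBound_nonneg (.reading (.act m (certificate P w t))) hh
      simp only [conf]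
      rw [← ENNReal.ofReal_one, ← ENNReal.ofReal_add zero_le_one h1]
      refine ENNReal.ofReal_le_ofReal (le_of_eq ?_)
      simp only [timeBound]
      ring
    · exact absurd (Or.inl rfl) hnh
    · exact absurd (Or.inr rfl) hnh

lemma quadraticExpectedTime (θ : unitInterval) (hθ : 1 / 8 ≤ (θ : ℝ)) :
    (verifier θ).QuadraticExpectedTime := by
  -- `102422 = 2 · 51201 + 20`, by `(n + 1) ^ 2 ≤ 2 (n ^ 2 + 1)`.
  refine ⟨102422, fun w P => (expectedTime_le θ hθ P w).trans ?_⟩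
  rw [← ENNReal.ofReal_natCast]
  refine ENNReal.ofReal_le_ofReal ?_
  push_cast
  nlinarith [sq_nonneg ((w.length : ℝ) - 1)]

end PowerVerifier

/-! ### The languages and their uncountability -/

lemma upower64Word_injective : Function.Injective upower64Word := by
  intro k l h
  have h1 := congrArg List.length h
  simp only [upower64Word, List.length_replicate] at h1
  exact PNat.coe_injective (Nat.pow_right_injective (by norm_num) h1)

lemma eq_upower64Word {w : List Unit} {k : ℕ+} (h : w.length = 64 ^ (k : ℕ)) :
    w = upower64Word k :=
  List.eq_replicate_iff.2 ⟨h, fun _ _ => rfl⟩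

lemma mem_UPOWER64 {I : Set ℕ+} {w : List Unit} :
    w ∈ UPOWER64 I ↔ ∃ k ∈ I, w = upower64Word k := Iff.rfl

lemma UPOWER64_injective : Function.Injective UPOWER64 := by
  have hmem : ∀ (I : Set ℕ+) k, upower64Word k ∈ UPOWER64 I ↔ k ∈ I := by
    intro I k
    rw [mem_UPOWER64]
    constructor
    · rintro ⟨l, hl, h⟩
      rwa [upower64Word_injective h]
    · exact fun h => ⟨k, h, rfl⟩
  intro I J h
  ext k
  rw [← hmem I, ← hmem J, h]

lemma not_countable_range_UPOWER64 : ¬ (Set.range UPOWER64).Countable := by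
  intro h
  have h1 : Countable (Set ℕ+) := by
    have := h.to_subtype
    exact (Set.rangeFactorization_injective.2 UPOWER64_injective).countable
  obtain ⟨f, hf⟩ := exists_surjective_nat (Set ℕ+)
  exact Function.cantor_surjective (f ∘ PNat.natPred)
    (hf.comp fun n => ⟨n.succPNat, Nat.natPred_succPNat n⟩)

/-! ### The honest certificate and the error bounds -/

namespace PowerVerifier

/-- The end of the block of length `64 ^ j` in the chain that starts with the block of length
`64 ^ k`. -/
def chainEnd (k j : ℕ) : ℕ := ∑ i ∈ Finset.Ico j (k + 1), 64 ^ i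

lemma chainEnd_antitone (k : ℕ) : Antitone (chainEnd k) := fun _ _ h =>
  Finset.sum_le_sum_of_subset (Finset.Ico_subset_Ico_left h)

lemma chainEnd_eq {k j : ℕ} (hj : j ≤ k) : chainEnd k j = chainEnd k (j + 1) + 64 ^ j := by
  unfold chainEnd
  rw [Finset.sum_eq_sum_Ico_succ_bot (by omega), add_comm]

open Classical in
/-- The correct certificate for an input of length `64 ^ k`. -/
noncomputable def honest (k : ℕ) (i : ℕ) : Sym where
  first := decide (64 ^ k ∣ i + 1)
  second := decide (64 ^ k + 1 ∣ i + 1)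
  -- The last alternative adds a second block of length one, for the check that has already consumed
  -- the first one as part of a pair.
  chain := decide ((∃ j ≤ k, i + 1 = chainEnd k j) ∨ i = chainEnd k 0)

lemma honest_mark (k : ℕ) (d : Bool) (i : ℕ) :
    (honest k i).mark d = true ↔ period (64 ^ k) d ∣ i + 1 := by
  cases d <;> simp [Sym.mark, honest, period]

lemma honest_both (k i : ℕ) :
    (honest k i).both = true ↔ 64 ^ k * (64 ^ k + 1) ∣ i + 1 := by
  have hc : Nat.Coprime (64 ^ k) (64 ^ k + 1) := by simp
  simp only [Sym.both, honest, Bool.and_eq_true, decide_eq_true_eq]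
  exact ⟨fun h => hc.mul_dvd_of_dvd_of_dvd h.1 h.2,
    fun h => ⟨(Dvd.intro _ rfl).trans h, (Dvd.intro_left _ rfl).trans h⟩⟩

lemma honest_isBlock {k j : ℕ} (hj : j ≤ k) :
    IsBlock (honest k) (chainEnd k (j + 1)) (64 ^ j) := by
  have hpos : 0 < 64 ^ j := by positivity
  have he := chainEnd_eq hj
  refine ⟨64 ^ j - 1, by omega, fun i hi => ?_, ?_⟩
  · simp only [honest, decide_eq_false_iff_not, not_or, not_exists, not_and]
    refine ⟨fun j' _ h => ?_, fun h => ?_⟩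
    · rcases Nat.lt_or_ge j j' with hlt | hge
      · have := chainEnd_antitone k (show j + 1 ≤ j' from hlt)
        omega
      · have := chainEnd_antitone k hge
        omega
    · have := chainEnd_antitone k (Nat.zero_le j)
      omega
  · simp only [honest, decide_eq_true_eq]
    exact Or.inl ⟨j, hj, by omega⟩

namespace IsValue

variable {θ : unitInterval} {w : List Unit} {σ : ℕ → Sym} {a r : ℝ} {v : St → ℕ → ℕ → ℝ}

/-- The error of the counting mode. -/
lemma cnt_error (hv : IsValue θ w σ a r v) (hr : r ≤ 1) {k T E x : ℕ} {ρ : ℝ}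
    (hw : w.length = 64 ^ k) (hT : (σ T).both = true) (hT' : ∀ i < T, (σ i).both = false)
    (hTn : T + 1 = w.length * (w.length + 1)) (hx : x ≤ 1) (hρ : 1 / 4 ≤ ρ) (hρ' : ρ ≤ 3 / 4)
    (hE : 64 ^ k * (θ : ℝ) / 16 = 2 * E + x + ρ)
    (hdec : ∀ s : ZMod 32, (16 ≤ s.val ↔ x = 1) → v (decision s) 0 0 = 0) :
    v (.communicating (.cnt 0)) 0 0 ≤ 1 / 64 + w.length * lapse w.length := by
  have hM : (0 : ℝ) < w.length + 1 := by positivity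
  -- `μ` is the mean number of heads in `n (n + 1)` tosses, and `W` corresponds to four passes, the
  -- margin of `pass_parity`.
  have h := hv.cnt_le hr hT hT' (μ := w.length * (w.length + 1) * θ)
    (W := 4 * (w.length + 1)) (by positivity)
    (fun q h hh hC => hdec q (pass_parity hx hw hρ hρ' hE hh hC)) T 0 0 0 (by omega)
    (Nat.zero_le _)
  have hTr : (T : ℝ) + 1 = w.length * (w.length + 1) := by exact_mod_cast hTn
  push_cast at h
  rw [zero_add (T : ℝ), hTr] at h
  refine h.trans ?_
  have e : (w.length : ℝ) * (w.length + 1) / (w.length + 1) = w.length := by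
    field_simp
  rw [e, mul_comm (lapse _)]
  refine add_le_add ?_ le_rfl
  rw [div_le_div_iff₀ (by positivity) (by norm_num)]
  have hθ : (θ : ℝ) * (1 - θ) ≤ 1 / 4 := by nlinarith [sq_nonneg ((θ : ℝ) - 1 / 2)]
  have hn : (0 : ℝ) ≤ w.length := Nat.cast_nonneg _
  -- The variance is at most `(n + 1) ^ 2 / 4`; divided by `W ^ 2 = 16 (n + 1) ^ 2` it gives 1/64.
  have h1 : (w.length : ℝ) * (w.length + 1) * (θ * (1 - θ)) ≤
      (w.length + 1) * (w.length + 1) * (1 / 4) := by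
    have hθ0 : (0 : ℝ) ≤ θ * (1 - θ) := mul_nonneg θ.2.1 (sub_nonneg.2 θ.2.2)
    have hn1 : (w.length : ℝ) ≤ w.length + 1 := by linarith
    exact mul_le_mul (mul_le_mul_of_nonneg_right hn1 hM.le) hθ hθ0 (by positivity)
  nlinarith

/-- On a word outside the language, the verifier accepts with probability less than `23 / 50`. -/
lemma soundness (hv : IsValue θ w σ 1 0 v) {I : Set ℕ+} [DecidablePred (· ∈ I)]
    (hI : ∀ k : ℕ+, ∃ E : ℕ, ∃ ρ : ℝ, 1 / 4 ≤ ρ ∧ ρ ≤ 3 / 4 ∧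
      64 ^ (k : ℕ) * (θ : ℝ) / 16 = 2 * E + (if k ∈ I then 1 else 0) + ρ)
    (hw : w ∉ UPOWER64 I) : v (.reading (.look 0)) 0 0 ≤ 23 / 50 := by
  rcases Nat.lt_or_ge 1 w.length with hw2 | hw1
  swap
  · rw [hv.init_of_length_le_one hw1]
    norm_num
  have hw0 : 0 < w.length := by omega
  rw [hv.init_eq hw2]
  have hpos : ∀ m t, 0 < v (.reading (.ret m)) 0 t →
      0 < v (.communicating m) (entryPos m) t := by
    intro m t h
    rw [hv.cycle_zero] at h
    exact pos_of_mul_pos_right h (by linarith [lapse_lt_one w.length])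
  have hle := fun m => hv.le_one (.reading (.ret m)) 0 0
  have h0 := hle (.lap false)
  have h1 := hle (.lap true)
  have h2 := hle .whole
  have h3 := hle (.up 0)
  have h4 := hle (.cnt 0)
  -- If one of the first four modes never accepts, the other modes contribute at most 4/9.
  by_cases p0 : 0 < v (.reading (.ret (.lap false))) 0 0
  swap
  · linarith
  by_cases p1 : 0 < v (.reading (.ret (.lap true))) 0 0
  swap
  · linarith
  by_cases p2 : 0 < v (.reading (.ret .whole)) 0 0
  swap
  · linarith
  by_cases p3 : 0 < v (.reading (.ret (.up 0))) 0 0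
  swap
  · linarith
  obtain ⟨T, hT1, hT2, hT3⟩ := hv.lap_sound hw0 false (hpos _ _ p0)
  obtain ⟨T', hT1', hT2', hT3'⟩ := hv.lap_sound hw0 true (hpos _ _ p1)
  obtain rfl : T = T' := by
    rcases lt_trichotomy T T' with h | h | h
    · simp [hT3' T h] at hT2
    · exact h
    · simp [hT3 T' h] at hT2'
  have hTb := hT2
  simp only [Sym.both, Bool.and_eq_true] at hTb
  have hd1 : w.length ∣ T + 1 := (hT1 T le_rfl).1 hTb.1
  have hd2 : w.length + 1 ∣ T + 1 := (hT1' T le_rfl).1 hTb.2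
  have hd := (show Nat.Coprime w.length (w.length + 1) by simp).mul_dvd_of_dvd_of_dvd hd1 hd2
  -- A later first coincidence is impossible: the marks are correct up to `T` and would already meet
  -- at `n (n + 1)`.
  have hTn : T + 1 = w.length * (w.length + 1) := by
    by_contra hne
    have hlt := lt_of_le_of_ne (Nat.le_of_dvd (by omega) hd) (Ne.symm hne)
    have hp : 0 < w.length * (w.length + 1) := by positivity
    have hb := hT3 (w.length * (w.length + 1) - 1) (by omega)
    have e : w.length * (w.length + 1) - 1 + 1 = w.length * (w.length + 1) := by omega
    have m1 := (hT1 (w.length * (w.length + 1) - 1) (by omega)).2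
      (by rw [e]; exact Dvd.intro _ rfl)
    have m2 := (hT1' (w.length * (w.length + 1) - 1) (by omega)).2
      (by rw [e]; exact Dvd.intro_left _ rfl)
    simp only [Sym.mark] at m1 m2
    simp [Sym.both, m1, m2] at hb
  have hblock := hv.whole_sound hw0 (hpos _ _ p2)
  have p4 := hpos _ _ p2
  rw [hv.whole_eq hblock] at p4
  obtain ⟨j, hj⟩ := hv.chain_sound w.length 0 hblock (hpos _ _ p3)
    (by rw [zero_add]; exact hpos _ _ p4)
  have hj0 : 0 < j := by
    rcases Nat.eq_zero_or_pos j with rfl | h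
    · rw [pow_zero] at hj; omega
    · exact h
  obtain ⟨k, rfl⟩ : ∃ k : ℕ+, (k : ℕ) = j := ⟨⟨j, hj0⟩, rfl⟩
  have hkI : k ∉ I := fun hmem => hw ⟨k, hmem, eq_upower64Word hj⟩
  obtain ⟨E, ρ, hρ, hρ', hE⟩ := hI k
  rw [if_neg hkI] at hE
  have hc := hv.cnt_error zero_le_one hj hT2 hT3 hTn (x := 0) (by norm_num) hρ hρ'
    (by push_cast; exact hE) (fun s hs => by
      have : ¬ 16 ≤ s.val := by rw [hs]; norm_num
      rw [decision, if_neg this, hv.reject])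
  have hcyc := hv.cycle_le zero_le_one (.cnt 0) 0 0
  change _ ≤ v (.communicating (.cnt 0)) 0 0 + _ at hcyc
  have hlapse : (w.length + 1) * lapse w.length = 1 / 64 := by
    unfold lapse
    field_simp
  -- Four modes contribute at most 4/9, the counting mode at most `(1/64 + 1/64) / 9`.
  linarith

/-- On a word of the language, the verifier rejects with probability less than `23 / 50` if the
certificate is correct. -/
lemma completeness {k : ℕ+} (hw : w.length = 64 ^ (k : ℕ))
    (hv : IsValue θ w (honest k) 0 1 v)
    (hI : ∃ E : ℕ, ∃ ρ : ℝ, 1 / 4 ≤ ρ ∧ ρ ≤ 3 / 4 ∧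
      64 ^ (k : ℕ) * (θ : ℝ) / 16 = 2 * E + 1 + ρ) :
    v (.reading (.look 0)) 0 0 ≤ 23 / 50 := by
  have hw64 : 64 ≤ w.length := by
    rw [hw]
    exact Nat.le_self_pow k.pos.ne' 64
  have hw0 : 0 < w.length := by omega
  have hlapse : (w.length + 1) * lapse w.length = 1 / 64 := by
    unfold lapse
    field_simp
  have hl := lapse_pos w.length
  have hcyc := fun m t => hv.cycle_le le_rfl m 0 t
  have hprod : 0 < w.length * (w.length + 1) := by positivity
  have hlap : ∀ d m, (m + 1) * period w.length d = w.length * (w.length + 1) →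
      v (.communicating (.lap d)) (entryPos (.lap d)) 0 ≤ m * lapse w.length := by
    intro d m hm
    refine hv.lap_complete hw0 d m 0 (fun i _ => ?_) ?_
    · rw [zero_add, honest_mark, hw]
    · rw [honest_both, ← hw, hm]
      exact dvd_of_eq (by omega)
  have h0 := hlap false w.length (by simp only [period, Bool.false_eq_true, if_false]; ring)
  have h1 := hlap true (w.length - 1) (by
    simp only [period, if_true]; rw [Nat.sub_add_cancel hw0])
  rw [Nat.cast_sub hw0] at h1
  have hchain := hv.chain_complete (fun j => chainEnd k (j + 1)) k hw.ge
    (fun j hj => chainEnd_eq hj) (fun j hj => honest_isBlock hj) (by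
      simp only [honest, decide_eq_true_eq]
      exact Or.inr (chainEnd_eq (Nat.zero_le _)).symm)
  have hkw : ((k : ℕ) : ℝ) ≤ w.length := by
    rw [hw]
    exact_mod_cast (Nat.lt_pow_self (n := k) (show 1 < 64 by norm_num)).le
  have hk0 : chainEnd k (k + 1) = 0 := by simp [chainEnd]
  have hk1 : chainEnd k k = w.length := by rw [chainEnd_eq le_rfl, hk0, hw, zero_add]
  have h3 := hchain k le_rfl
  simp only [hk0] at h3
  have h2 : v (.communicating .whole) (entryPos .whole) 0 ≤ k * lapse w.length := by
    have hb := honest_isBlock (le_refl (k : ℕ))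
    rw [hk0, ← hw] at hb
    rw [hv.whole_eq hb]
    refine (hcyc _ _).trans ?_
    have h4 := hchain (k - 1) (by omega)
    have hkk : (k : ℕ) - 1 + 1 = k := Nat.sub_add_cancel k.pos
    simp only [hkk, hk1] at h4
    rw [Nat.cast_sub (show 1 ≤ (k : ℕ) from k.pos)] at h4
    change v (.communicating (.up 0)) 0 _ + _ ≤ _
    push_cast at h4
    linarith
  obtain ⟨E, ρ, hρ, hρ', hE⟩ := hI
  have h4 := hv.cnt_error le_rfl hw (T := w.length * (w.length + 1) - 1)
    (by rw [honest_both, ← hw]; exact dvd_of_eq (by omega))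
    (fun i hi => by
      rw [← Bool.not_eq_true, honest_both, ← hw]
      exact Nat.not_dvd_of_pos_of_lt (by omega) (by omega))
    (by omega) le_rfl hρ hρ' (by push_cast; exact hE) (fun s hs => by
      rw [decision, if_pos (hs.2 rfl), hv.accept])
  rw [hv.init_eq (by omega)]
  have c0 := hcyc (.lap false) 0
  have c1 := hcyc (.lap true) 0
  have c2 := hcyc .whole 0
  have c3 := hcyc (.up 0) 0
  have c4 := hcyc (.cnt 0) 0
  change _ ≤ v (.communicating (.up 0)) 0 0 + _ at c3
  change _ ≤ v (.communicating (.cnt 0)) 0 0 + _ at c4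
  have hkl := mul_le_mul_of_nonneg_right hkw hl.le
  push_cast at h1
  -- To the immediate rejection, 4/9, four modes add at most `(1/64) / 9` each and the counting mode
  -- at most `(1/32) / 9`.
  linarith

end IsValue

open Classical in
lemma verifies (I : Set ℕ+) : ∃ θ : unitInterval, 1 / 8 ≤ (θ : ℝ) ∧
    (verifier θ).Verifies (UPOWER64 I) (ENNReal.ofReal (23 / 50)) := by
  obtain ⟨θ, hθ, hI⟩ := exists_bias I
  -- The history includes the current message, so `h.length - 1` is the index of the requested
  -- symbol; the logarithm recovers `k`.
  refine ⟨θ, hθ, ⟨fun w h => honest (Nat.log 64 w.length) (h.length - 1), ?_⟩, ?_⟩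
  · rintro w ⟨k, hk, rfl⟩
    set P : (verifier θ).Prover := fun w h => honest (Nat.log 64 w.length) (h.length - 1)
    have hlen : (upower64Word k).length = 64 ^ (k : ℕ) := List.length_replicate
    have hcert : certificate P (upower64Word k) = honest k := by
      funext t
      simp [certificate, P, hlen, Nat.log_pow]
    have hv := isValue_rejectProb θ P (upower64Word k)
    rw [hcert] at hv
    have hle := hv.completeness hlen (by simpa [hk] using hI k)
    have hrej : (verifier θ).rejectProb P (upower64Word k) ≤ ENNReal.ofReal (23 / 50) := by
      rw [TwoPFAVerifier.rejectProb_eq]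
      exact (ENNReal.le_ofReal_iff_toReal_le (ne_top_of_le_ne_top ENNReal.one_ne_top
        ((verifier θ).haltProb_le_one _ _ _ _)) (by norm_num)).2 hle
    -- Halting with probability one turns the upper bound for rejection into a lower bound for
    -- acceptance.
    rw [tsub_le_iff_right, ← (verifier θ).acceptProb_add_rejectProb P (upower64Word k)
      (ne_top_of_le_ne_top ENNReal.ofReal_ne_top (expectedTime_le θ hθ P _))]
    gcongr
  · intro w hw P
    have hle := (isValue_acceptProb θ P w).soundness hI hw
    have hacc : (verifier θ).acceptProb P w ≤ ENNReal.ofReal (23 / 50) := by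
      rw [TwoPFAVerifier.acceptProb_eq]
      exact (ENNReal.le_ofReal_iff_toReal_le (ne_top_of_le_ne_top ENNReal.one_ne_top
        ((verifier θ).haltProb_le_one _ _ _ _)) (by norm_num)).2 hle
    rw [tsub_le_iff_left, ← (verifier θ).acceptProb_add_rejectProb P w
      (ne_top_of_le_ne_top ENNReal.ofReal_ne_top (expectedTime_le θ hθ P _))]
    gcongr

end PowerVerifier

lemma verifiableInQuadraticTime_UPOWER64 (I : Set ℕ+) :
    VerifiableInQuadraticTime (UPOWER64 I) := by
  obtain ⟨θ, hθ, hV⟩ := PowerVerifier.verifies I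
  refine ⟨PowerVerifier.verifier θ, ⟨_, ?_, hV⟩, PowerVerifier.quadraticExpectedTime θ hθ⟩
  rw [ENNReal.ofReal_lt_iff_lt_toReal (by norm_num) (by simp)]
  norm_num

theorem theorem10 :
    (∀ I : Set ℕ+, VerifiableInQuadraticTime (UPOWER64 I)) ∧
    ¬ {L : Language Unit | VerifiableInQuadraticTime L}.Countable := by
  refine ⟨verifiableInQuadraticTime_UPOWER64, fun h => not_countable_range_UPOWER64 (h.mono ?_)⟩
  rintro _ ⟨I, rfl⟩
  exact verifiableInQuadraticTime_UPOWER64 I
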